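/- Let $(M^3,g)$ be a smooth 3-dimensional Riemannian manifold with Levi-Civita connection $\nabla$, curvature $R(X,Y)=\nabla^2_{X,Y}-\nabla^2_{Y,X}$ and Ricci form $\mathrm{ric}(X,Y)=\operatorname{tr}(Z\mapsto R(Z,X)Y)$. For $X\in T_pM$ let $$\mathcal J(X)=R(\cdot,X)X,\qquad \mathcal J'(X)=(\nabla_XR)(\cdot,X)X$$ be the Jacobi operator and its derivative. Both preserve $X^\perp$; let $\mathring{\mathcal J}(X)$ and $\mathring{\mathcal J}'(X)$ be the endomorphisms $\mathcal J(X)-\tfrac12\operatorname{tr}(\mathcal J(X))\,\mathrm{id}_{X^\perp}$ and $\mathcal J'(X)-\tfrac12\operatorname{tr}(\mathcal J'(X))\,\mathrm{id}_{X^\perp}$ of $X^\perp$. Put $$D_1(X)=(\nabla_X\mathrm{ric})(X,X),\qquad D_2(X)=2\operatorname{tr}(\mathcal J(X)\circ\mathcal J(X))-\mathrm{ric}(X,X)^2+(\nabla^2_{X,X}\mathrm{ric})(X,X),$$ $$D(X)=\det\nolimits_{X^\perp}\bigl(\mathring{\mathcal J}(X)\circ\mathring{\mathcal J}'(X)-\mathring{\mathcal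 J}'(X)\circ\mathring{\mathcal J}(X)\bigr),$$ $$P(X)=\operatorname{tr}(\mathring{\mathcal J}\circ\mathring{\mathcal J})\,D_2(X)-\operatorname{tr}(\mathring{\mathcal J}\circ\mathring{\mathcal J}')\,D_1(X).$$ **Theorem 3.1.** On each tangent space $T_pM$ the functions $D_1$, $D_2$, $D$, $P$ are homogeneous polynomials of degrees $3,4,10,8$ (possibly zero), and $$P^2-D\bigl(-D_1^2-4\operatorname{tr}(\mathring{\mathcal J}\circ\mathring{\mathcal J})\,\mathrm{ric}(X,X)\bigr)$$ is a homogeneous polynomial of degree $16$ (possibly zero). Suppose that for every unit tangent vector $(p,v)$ there are $\varepsilon>0$ and a differentiable field $u=u(t)\in\mathrm{End}(T_{\gamma(t)}M)$, $|t|<\varepsilon$, along the geodesic $\gamma$ with $\gamma(0)=p$, $\gamma'(0)=v$, such that $$u'(t)+u(t)^2+\mathcal J(\gamma'(t))=0,$$ $u(t)$ is symmetric and trace-free, and $u(t)\gamma'(t)=0$. Then for all $X\in TM$ $$P(X)^2=D(X)\bigl(-D_1(X)^2-4\operatorname{tr}(\mathring{\mathcal J}(X)\circ\mathring{\mathcal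 J}(X))\,\mathrm{ric}(X,X)\bigr).$$ -/

import Mathlib

open scoped Manifold ContDiff Topology

set_option maxSynthPendingDepth 3

noncomputable section

/-- The model space of a 3-manifold. -/
abbrev E3 : Type := EuclideanSpace ℝ (Fin 3)

/-! ### Levi-Civita calculus in a chart

`G` is the coordinate expression of a metric: `G y v w` is the scalar product at the point `y` of
the chart of the vectors `v`, `w`. -/

section Chart

variable {E : Type*} [NormedAddCommGroup E] [NormedSpace ℝ E]

/-- The Koszul form `v w z ↦ ∂_v G(w,z) + ∂_w G(v,z) - ∂_z G(v,w)`. -/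
def koszul (G : E → E →L[ℝ] E →L[ℝ] ℝ) (y : E) : E →L[ℝ] E →L[ℝ] E →L[ℝ] ℝ :=
  fderiv ℝ G y + (fderiv ℝ G y).flip
    - ((ContinuousLinearMap.flipₗᵢ ℝ E E ℝ).toContinuousLinearEquiv : _ →L[ℝ] _)
        ∘L (fderiv ℝ G y).flip

theorem koszul_apply (G : E → E →L[ℝ] E →L[ℝ] ℝ) (y v w z : E) :
    koszul G y v w z = fderiv ℝ G y v w z + fderiv ℝ G y w v z - fderiv ℝ G y z v w := rfl

/-- The Christoffel symbols `Γ(v,w)` of the Levi-Civita connection: for a nondegenerate `G y`,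
`2 G(Γ(v,w),z) = ∂_v G(w,z) + ∂_w G(v,z) - ∂_z G(v,w)`. -/
def christoffel (G : E → E →L[ℝ] E →L[ℝ] ℝ) (y : E) : E →L[ℝ] E →L[ℝ] E :=
  (1 / 2 : ℝ) • (ContinuousLinearMap.compL ℝ E (E →L[ℝ] ℝ) E (G y).inverse ∘L koszul G y)

theorem christoffel_apply (G : E → E →L[ℝ] E →L[ℝ] ℝ) (y v w : E) :
    christoffel G y v w = (1 / 2 : ℝ) • (G y).inverse (koszul G y v w) := rfl

/-- The quadratic part `(v,w) ↦ Γ_v ∘ Γ_w` of the curvature. -/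
def christoffelComp (G : E → E →L[ℝ] E →L[ℝ] ℝ) (y : E) : E →L[ℝ] E →L[ℝ] E →L[ℝ] E :=
  (ContinuousLinearMap.compL ℝ E E E).bilinearComp (christoffel G y) (christoffel G y)

/-- The Riemann curvature tensor `R(v,w) = ∇²_{v,w} - ∇²_{w,v}`, an endomorphism-valued 2-form. -/
def riemann (G : E → E →L[ℝ] E →L[ℝ] ℝ) (y : E) : E →L[ℝ] E →L[ℝ] E →L[ℝ] E :=
  fderiv ℝ (christoffel G) y - (fderiv ℝ (christoffel G) y).flip
    + (christoffelComp G y - (christoffelComp G y).flip)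

theorem riemann_apply (G : E → E →L[ℝ] E →L[ℝ] ℝ) (y v w z : E) :
    riemann G y v w z =
      fderiv ℝ (christoffel G) y v w z - fderiv ℝ (christoffel G) y w v z
        + (christoffel G y v (christoffel G y w z) - christoffel G y w (christoffel G y v z)) :=
  rfl

/-- The covariant derivative `(∇_x R)(a,b)c`. -/
def covRiemann (G : E → E →L[ℝ] E →L[ℝ] ℝ) (y x a b c : E) : E :=
  fderiv ℝ (riemann G) y x a b c + christoffel G y x (riemann G y a b c)
    - riemann G y (christoffel G y x a) b c - riemann G y a (christoffel G y x b) c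
    - riemann G y a b (christoffel G y x c)

/-- The Jacobi operator `Y ↦ R(Y,x)x`. -/
def jacobi (G : E → E →L[ℝ] E →L[ℝ] ℝ) (y x : E) : E →L[ℝ] E :=
  ((riemann G y).flip x).flip x

theorem jacobi_apply (G : E → E →L[ℝ] E →L[ℝ] ℝ) (y x Y : E) :
    jacobi G y x Y = riemann G y Y x x := rfl

/-- The derived Jacobi operator `Y ↦ (∇_x R)(Y,x)x`; along a geodesic `γ` its value at `γ'` is the
covariant derivative of the Jacobi operator of `γ'`. -/
def derivedJacobi (G : E → E →L[ℝ] E →L[ℝ] ℝ) (y x : E) : E →ₗ[ℝ] E where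
  toFun Y := covRiemann G y x Y x x
  map_add' Y Z := by
    simp only [covRiemann, map_add, add_apply]
    abel
  map_smul' a Y := by
    simp only [covRiemann, map_smul, smul_apply, RingHom.id_apply, smul_sub, smul_add]

/-- The Ricci form `ric(a,b) = tr (z ↦ R(z,a)b)`. -/
def ricci (G : E → E →L[ℝ] E →L[ℝ] ℝ) (y a b : E) : ℝ :=
  LinearMap.trace ℝ E (((riemann G y).flip a).flip b : E →L[ℝ] E)

/-- The covariant derivative `(∇_x ric)(a,b)`. -/
def covRicci (G : E → E →L[ℝ] E →L[ℝ] ℝ) (y x a b : E) : ℝ :=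
  fderiv ℝ (fun z => ricci G z a b) y x
    - ricci G y (christoffel G y x a) b - ricci G y a (christoffel G y x b)

/-- The second covariant derivative `(∇²_{w,x} ric)(a,b)`. -/
def covRicci2 (G : E → E →L[ℝ] E →L[ℝ] ℝ) (y w x a b : E) : ℝ :=
  fderiv ℝ (fun z => covRicci G z x a b) y w
    - covRicci G y (christoffel G y w x) a b
    - covRicci G y x (christoffel G y w a) b - covRicci G y x a (christoffel G y w b)

end Chart

/-! ### Geometry of a Riemannian 3-manifold -/

section Manifold

variable {M : Type*} [TopologicalSpace M] [ChartedSpace E3 M] [IsManifold (𝓡 3) ∞ M]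

/-- Smooth Riemannian metrics on the 3-manifold `M`. -/
abbrev RiemannianMetric3 (M : Type*) [TopologicalSpace M] [ChartedSpace E3 M]
    [IsManifold (𝓡 3) ∞ M] : Type _ :=
  Bundle.ContMDiffRiemannianMetric (𝓡 3) ∞ E3 (fun x : M => TangentSpace (𝓡 3) x)

/-- The differential at `x` of the preferred chart around `p`. It is invertible for `x` in the
domain of that chart. -/
def chartDiff (p x : M) : TangentSpace (𝓡 3) x →L[ℝ] E3 :=
  mfderiv (𝓡 3) 𝓘(ℝ, E3) (extChartAt (𝓡 3) p) x

/-- The inverse of the differential at `x` of the preferred chart around `p`. -/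
def chartDiffInv (p x : M) : E3 →L[ℝ] TangentSpace (𝓡 3) x :=
  (chartDiff p x).inverse

/-- The coordinate expression of the metric in the preferred chart around `p`. -/
def chartMetric (g : RiemannianMetric3 M) (p : M) (y : E3) : E3 →L[ℝ] E3 →L[ℝ] ℝ :=
  (chartDiffInv p ((extChartAt (𝓡 3) p).symm y)).precomp ℝ
    ∘L g.inner ((extChartAt (𝓡 3) p).symm y) ∘L chartDiffInv p ((extChartAt (𝓡 3) p).symm y)

theorem chartMetric_apply (g : RiemannianMetric3 M) (p : M) (y v w : E3) :
    chartMetric g p y v w = g.inner ((extChartAt (𝓡 3) p).symm y)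
      (chartDiffInv p ((extChartAt (𝓡 3) p).symm y) v)
      (chartDiffInv p ((extChartAt (𝓡 3) p).symm y) w) := rfl

/-- The Jacobi operator `J(X) = R(·,X)X` on `T_pM`. -/
def jacobiAt (g : RiemannianMetric3 M) (p : M) (X : TangentSpace (𝓡 3) p) :
    TangentSpace (𝓡 3) p →ₗ[ℝ] TangentSpace (𝓡 3) p :=
  (chartDiffInv p p : E3 →ₗ[ℝ] TangentSpace (𝓡 3) p)
    ∘ₗ (jacobi (chartMetric g p) (extChartAt (𝓡 3) p p) (chartDiff p p X) : E3 →ₗ[ℝ] E3)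
    ∘ₗ (chartDiff p p : TangentSpace (𝓡 3) p →ₗ[ℝ] E3)

/-- The derived Jacobi operator `J'(X) = (∇_X R)(·,X)X` on `T_pM`. -/
def derivedJacobiAt (g : RiemannianMetric3 M) (p : M) (X : TangentSpace (𝓡 3) p) :
    TangentSpace (𝓡 3) p →ₗ[ℝ] TangentSpace (𝓡 3) p :=
  (chartDiffInv p p : E3 →ₗ[ℝ] TangentSpace (𝓡 3) p)
    ∘ₗ derivedJacobi (chartMetric g p) (extChartAt (𝓡 3) p p) (chartDiff p p X)
    ∘ₗ (chartDiff p p : TangentSpace (𝓡 3) p →ₗ[ℝ] E3)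

/-- `ric(X,X)`. -/
def ricAt (g : RiemannianMetric3 M) (p : M) (X : TangentSpace (𝓡 3) p) : ℝ :=
  ricci (chartMetric g p) (extChartAt (𝓡 3) p p) (chartDiff p p X) (chartDiff p p X)

/-- `D₁(X) = (∇_X ric)(X,X)`. -/
def invD1 (g : RiemannianMetric3 M) (p : M) (X : TangentSpace (𝓡 3) p) : ℝ :=
  covRicci (chartMetric g p) (extChartAt (𝓡 3) p p)
    (chartDiff p p X) (chartDiff p p X) (chartDiff p p X)

/-- `D₂(X) = 2 tr(J(X) ∘ J(X)) - ric(X,X)² + (∇²_{X,X} ric)(X,X)`. -/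
def invD2 (g : RiemannianMetric3 M) (p : M) (X : TangentSpace (𝓡 3) p) : ℝ :=
  2 * LinearMap.trace ℝ (TangentSpace (𝓡 3) p) (jacobiAt g p X ∘ₗ jacobiAt g p X)
    - ricAt g p X ^ 2
    + covRicci2 (chartMetric g p) (extChartAt (𝓡 3) p p)
        (chartDiff p p X) (chartDiff p p X) (chartDiff p p X) (chartDiff p p X)

/-- The orthogonal complement `X^⊥` in `T_pM`. -/
def perp (g : RiemannianMetric3 M) (p : M) (X : TangentSpace (𝓡 3) p) :
    Submodule ℝ (TangentSpace (𝓡 3) p) :=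
  LinearMap.ker (g.inner p X : TangentSpace (𝓡 3) p →ₗ[ℝ] ℝ)

theorem sub_proj_mem_perp (g : RiemannianMetric3 M) (p : M) (X Z : TangentSpace (𝓡 3) p) :
    Z - (g.inner p X Z / g.inner p X X) • X ∈ perp g p X := by
  by_cases hX : X = 0
  · subst hX
    simp [perp]
  · have h : g.inner p X X ≠ 0 := (g.pos p X hX).ne'
    simp only [perp, LinearMap.mem_ker, ContinuousLinearMap.coe_coe, map_sub, map_smul,
      smul_eq_mul]
    field_simp
    ring

/-- An endomorphism `f` of `T_pM` seen as an endomorphism of `X^⊥`: the restriction of `f` to `X^⊥`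
followed by the orthogonal projection onto `X^⊥`. This is the plain restriction when `f` preserves
`X^⊥`, as `J(X)` and `J'(X)` do. -/
def onPerp (g : RiemannianMetric3 M) (p : M) (X : TangentSpace (𝓡 3) p)
    (f : TangentSpace (𝓡 3) p →ₗ[ℝ] TangentSpace (𝓡 3) p) : perp g p X →ₗ[ℝ] perp g p X where
  toFun Y := ⟨f Y - (g.inner p X (f Y) / g.inner p X X) • X, sub_proj_mem_perp g p X (f Y)⟩
  map_add' Y Z := by
    ext1
    simp only [Submodule.coe_add, map_add, add_div, add_smul]
    abel
  map_smul' a Y := by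
    ext1
    simp only [Submodule.coe_smul, map_smul, smul_eq_mul, mul_div_assoc, mul_smul, smul_sub,
      RingHom.id_apply]

/-- The trace-free part on `X^⊥`: `f - ½ tr(f) id`, for `f` seen as an endomorphism of `X^⊥`. -/
def ringPart (g : RiemannianMetric3 M) (p : M) (X : TangentSpace (𝓡 3) p)
    (f : TangentSpace (𝓡 3) p →ₗ[ℝ] TangentSpace (𝓡 3) p) : perp g p X →ₗ[ℝ] perp g p X :=
  onPerp g p X f - (1 / 2 * LinearMap.trace ℝ (perp g p X) (onPerp g p X f)) • LinearMap.id

/-- The trace-free Jacobi operator of `X^⊥`. -/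
def ringJ (g : RiemannianMetric3 M) (p : M) (X : TangentSpace (𝓡 3) p) :
    perp g p X →ₗ[ℝ] perp g p X :=
  ringPart g p X (jacobiAt g p X)

/-- The trace-free derived Jacobi operator of `X^⊥`. -/
def ringJ' (g : RiemannianMetric3 M) (p : M) (X : TangentSpace (𝓡 3) p) :
    perp g p X →ₗ[ℝ] perp g p X :=
  ringPart g p X (derivedJacobiAt g p X)

/-- The trace on `X^⊥` of the square of the trace-free Jacobi operator. -/
def trRingJJ (g : RiemannianMetric3 M) (p : M) (X : TangentSpace (𝓡 3) p) : ℝ :=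
  LinearMap.trace ℝ (perp g p X) (ringJ g p X ∘ₗ ringJ g p X)

/-- The trace on `X^⊥` of the product of the trace-free parts of `J(X)` and `J'(X)`. -/
def trRingJJ' (g : RiemannianMetric3 M) (p : M) (X : TangentSpace (𝓡 3) p) : ℝ :=
  LinearMap.trace ℝ (perp g p X) (ringJ g p X ∘ₗ ringJ' g p X)

/-- `D(X)`: the determinant on `X^⊥` of the commutator of the trace-free parts of `J(X)` and
`J'(X)`. -/
def invD (g : RiemannianMetric3 M) (p : M) (X : TangentSpace (𝓡 3) p) : ℝ :=
  LinearMap.det (ringJ g p X ∘ₗ ringJ' g p X - ringJ' g p X ∘ₗ ringJ g p X)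

/-- `P(X)`. -/
def invP (g : RiemannianMetric3 M) (p : M) (X : TangentSpace (𝓡 3) p) : ℝ :=
  trRingJJ g p X * invD2 g p X - trRingJJ' g p X * invD1 g p X

/-! ### Geodesics and the Riccati equation -/

/-- A curve in `M` read in the preferred chart around `p`. -/
def chartCurve (p : M) (γ : ℝ → M) (t : ℝ) : E3 :=
  extChartAt (𝓡 3) p (γ t)

/-- A field of endomorphisms along a curve, read in the preferred chart around `p`. -/
def chartEndo (p : M) (γ : ℝ → M)
    (u : ∀ t, TangentSpace (𝓡 3) (γ t) →L[ℝ] TangentSpace (𝓡 3) (γ t)) (t : ℝ) : E3 →L[ℝ] E3 :=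
  chartDiff p (γ t) ∘L u t ∘L chartDiffInv p (γ t)

/-- On the time interval `(-ε, ε)` the curve `γ` runs in the domain of the preferred chart around
`p` and is the geodesic with `γ(0) = p`, `γ'(0) = v`. -/
structure IsGeodesicFrom (g : RiemannianMetric3 M) (p : M) (v : TangentSpace (𝓡 3) p) (ε : ℝ)
    (γ : ℝ → M) : Prop where
  mem_source : ∀ t ∈ Set.Ioo (-ε) ε, γ t ∈ (chartAt E3 p).source
  contDiffOn : ContDiffOn ℝ 2 (chartCurve p γ) (Set.Ioo (-ε) ε)
  start : γ 0 = p
  velocity : deriv (chartCurve p γ) 0 = chartDiff p p v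
  geodesic : ∀ t ∈ Set.Ioo (-ε) ε,
    deriv (deriv (chartCurve p γ)) t
      + christoffel (chartMetric g p) (chartCurve p γ t)
          (deriv (chartCurve p γ) t) (deriv (chartCurve p γ) t) = 0

/-- The covariant derivative `u' = ∇_{γ'} u` along `γ` of a field of endomorphisms, in the preferred
chart around `p`. -/
def covDerivEndo (g : RiemannianMetric3 M) (p : M) (γ : ℝ → M)
    (u : ∀ t, TangentSpace (𝓡 3) (γ t) →L[ℝ] TangentSpace (𝓡 3) (γ t)) (t : ℝ) : E3 →L[ℝ] E3 :=
  deriv (chartEndo p γ u) t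
    + christoffel (chartMetric g p) (chartCurve p γ t) (deriv (chartCurve p γ) t)
        ∘L chartEndo p γ u t
    - chartEndo p γ u t
        ∘L christoffel (chartMetric g p) (chartCurve p γ t) (deriv (chartCurve p γ) t)

/-- On `(-ε, ε)` the field `u` along `γ` is differentiable, solves the Riccati equation
`u' + u² + J(γ') = 0`, is symmetric and trace-free, and annihilates `γ'`. -/
structure IsConstrainedRiccatiSolution (g : RiemannianMetric3 M) (p : M) (ε : ℝ) (γ : ℝ → M)
    (u : ∀ t, TangentSpace (𝓡 3) (γ t) →L[ℝ] TangentSpace (𝓡 3) (γ t)) : Prop where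
  differentiableOn : DifferentiableOn ℝ (chartEndo p γ u) (Set.Ioo (-ε) ε)
  riccati : ∀ t ∈ Set.Ioo (-ε) ε,
    covDerivEndo g p γ u t + chartEndo p γ u t ∘L chartEndo p γ u t
      + jacobi (chartMetric g p) (chartCurve p γ t) (deriv (chartCurve p γ) t) = 0
  symmetric : ∀ t ∈ Set.Ioo (-ε) ε, ∀ x y : TangentSpace (𝓡 3) (γ t),
    g.inner (γ t) (u t x) y = g.inner (γ t) x (u t y)
  traceFree : ∀ t ∈ Set.Ioo (-ε) ε,
    LinearMap.trace ℝ (TangentSpace (𝓡 3) (γ t))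
      (u t : TangentSpace (𝓡 3) (γ t) →ₗ[ℝ] TangentSpace (𝓡 3) (γ t)) = 0
  velocity : ∀ t ∈ Set.Ioo (-ε) ε, chartEndo p γ u t (deriv (chartCurve p γ) t) = 0

/-- For every unit tangent vector `(p,v)` there is a short time solution of the Riccati equation
along the geodesic through `(p,v)` that satisfies the algebraic constraint. -/
def HasConstrainedRiccatiSolutions (g : RiemannianMetric3 M) : Prop :=
  ∀ (p : M) (v : TangentSpace (𝓡 3) p), g.inner p v v = 1 →
    ∃ ε > 0, ∃ γ : ℝ → M, IsGeodesicFrom g p v ε γ ∧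
      ∃ u : ∀ t, TangentSpace (𝓡 3) (γ t) →L[ℝ] TangentSpace (𝓡 3) (γ t),
        IsConstrainedRiccatiSolution g p ε γ u

end Manifold

/-- `f` is a homogeneous polynomial of degree `n` on the 3-dimensional space `V`, that is, a
polynomial in linear coordinates all of whose monomials have degree `n` (possibly zero). -/
def IsHomogeneousPolynomial {V : Type*} [AddCommGroup V] [Module ℝ V] (n : ℕ) (f : V → ℝ) : Prop :=
  ∃ (b : Module.Basis (Fin 3) ℝ V) (q : MvPolynomial (Fin 3) ℝ),
    q.IsHomogeneous n ∧ ∀ X, f X = MvPolynomial.eval (fun i => b.repr X i) q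

end

/-! Write `U`, `J`, `J'` for the Riccati field, the Jacobi operator and its derivative along a unit
speed geodesic. The trace of the Riccati equation gives `tr U² = -ric`. Differentiating this and
inserting the equation gives `2 tr(UJ) = D₁`, because `tr U³ = 0` for a trace-free `U` with a kernel
in dimension 3. Differentiating once more, and using that `U²` is `½ tr(U²)` times the identity on
the complement of the velocity, gives `2 tr(UJ') = D₂`.

Trace-free symmetric endomorphisms of a plane form a 2-dimensional Euclidean space for the trace
form. There the length of `U` and its products with the trace-free parts `A`, `B` of `J`, `J'` are
now known, and these data are dependent. The vector `|A|² B - ⟨A,B⟩ A` is orthogonal to `A`; twice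
its product with `U` is `P`, so `P² = 4 (|A|²|B|² - ⟨A,B⟩²)(|A|²|U|² - ⟨A,U⟩²)`. The first Gram
determinant equals the determinant `D` of the commutator of `A` and `B`, and four times the second
is `-D₁² - 4|A|² ric`. This is the relation for unit vectors (`trace_relation_of_symmetric`,
`IsRiccatiAlong.curvature_relation`).

All invariants become polynomial in `X` once traces and determinants over the varying plane `X^⊥`
are replaced by traces over the whole tangent space. This works because `J(X)` and `J'(X)`
annihilate `X`, and because `det C = -½ tr C²` for a trace-free `C` on a plane. The defect of the
relation is then homogeneous of degree 16, so its vanishing on unit vectors extends to all vectors.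

Everything is computed in one chart. Covariant derivatives of endomorphism fields there differ from
ordinary ones by commutators with Christoffel symbols, which cancel in the traces involved. -/

noncomputable section

/-! ### Smoothness and first identities of the curvature tensors in a chart -/

section ChartCalculus

variable {E : Type*} [NormedAddCommGroup E] [NormedSpace ℝ E]

/-- `G` is the coordinate expression of a smooth Riemannian metric on the open set `S`. -/
structure IsMetricOn (G : E → E →L[ℝ] E →L[ℝ] ℝ) (S : Set E) : Prop where
  isOpen : IsOpen S
  smooth : ∀ y ∈ S, ContDiffAt ℝ ∞ G y
  symm : ∀ y ∈ S, ∀ v w, G y v w = G y w v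
  pos : ∀ y ∈ S, ∀ v, v ≠ 0 → 0 < G y v v

/-- Flipping of continuous bilinear maps, as a continuous linear map. -/
def flipL (E F W : Type*) [NormedAddCommGroup E] [NormedSpace ℝ E] [NormedAddCommGroup F]
    [NormedSpace ℝ F] [NormedAddCommGroup W] [NormedSpace ℝ W] :
    (E →L[ℝ] F →L[ℝ] W) →L[ℝ] (F →L[ℝ] E →L[ℝ] W) :=
  (ContinuousLinearMap.flipₗᵢ ℝ E F W).toContinuousLinearEquiv

theorem ContDiffAt.clm_flip {X F W : Type*} [NormedAddCommGroup X] [NormedSpace ℝ X]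
    [NormedAddCommGroup F] [NormedSpace ℝ F] [NormedAddCommGroup W] [NormedSpace ℝ W]
    {n : WithTop ℕ∞} {f : X → E →L[ℝ] F →L[ℝ] W} {x : X} (hf : ContDiffAt ℝ n f x) :
    ContDiffAt ℝ n (fun z => (f z).flip) x :=
  (flipL E F W).contDiff.contDiffAt.comp x hf

theorem ContDiffAt.fderiv_smooth {F : Type*} [NormedAddCommGroup F] [NormedSpace ℝ F]
    {f : E → F} {y : E} (h : ContDiffAt ℝ ∞ f y) : ContDiffAt ℝ ∞ (fderiv ℝ f) y :=
  h.fderiv_right (by simp)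

theorem ContDiffAt.differentiableAt_smooth {F : Type*} [NormedAddCommGroup F] [NormedSpace ℝ F]
    {f : E → F} {y : E} (h : ContDiffAt ℝ ∞ f y) : DifferentiableAt ℝ f y :=
  h.differentiableAt (by simp)

variable {G : E → E →L[ℝ] E →L[ℝ] ℝ} {S : Set E}

theorem riemann_self (y v : E) : riemann G y v v = 0 := by
  ext z
  simp [riemann_apply]

theorem IsMetricOn.koszul_smooth (hG : IsMetricOn G S) {y : E} (hy : y ∈ S) :
    ContDiffAt ℝ ∞ (koszul G) y := by
  have h := (hG.smooth y hy).fderiv_smooth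
  unfold koszul
  refine (h.add h.clm_flip).sub ?_
  exact contDiffAt_const.clm_comp h.clm_flip

/-- The derived Jacobi operator as a continuous linear map. -/
def derivedJacobiL (G : E → E →L[ℝ] E →L[ℝ] ℝ) (y x : E) : E →L[ℝ] E :=
  (((fderiv ℝ (riemann G) y x).flip x).flip x) + christoffel G y x ∘L jacobi G y x
    - jacobi G y x ∘L christoffel G y x - ((riemann G y).flip (christoffel G y x x)).flip x
    - ((riemann G y).flip x).flip (christoffel G y x x)

theorem derivedJacobiL_apply (y x z : E) : derivedJacobiL G y x z = derivedJacobi G y x z := rfl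

section Smoothness

variable [FiniteDimensional ℝ E]

/-- Positive definiteness gives injectivity and dimensions agree. Invertibility is what makes
`ContinuousLinearMap.inverse`, hence the Christoffel symbols, depend smoothly on the point. -/
theorem IsMetricOn.isInvertible (hG : IsMetricOn G S) {y : E} (hy : y ∈ S) :
    (G y).IsInvertible := by
  have hinj : Function.Injective (G y : E →ₗ[ℝ] E →L[ℝ] ℝ) := by
    rw [← LinearMap.ker_eq_bot, LinearMap.ker_eq_bot']
    intro v hv
    by_contra hne
    have h := hG.pos y hy v hne
    have h0 : G y v = 0 := hv
    simp [h0] at h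
  have hdim : Module.finrank ℝ E = Module.finrank ℝ (E →L[ℝ] ℝ) := by
    rw [← (LinearMap.toContinuousLinearMap : (E →ₗ[ℝ] ℝ) ≃ₗ[ℝ] (E →L[ℝ] ℝ)).finrank_eq]
    exact (Subspace.dual_finrank_eq (K := ℝ) (V := E)).symm
  refine ⟨(LinearEquiv.ofInjectiveOfFinrankEq (G y : E →ₗ[ℝ] E →L[ℝ] ℝ) hinj
    hdim).toContinuousLinearEquiv, ?_⟩
  ext v w
  rfl

theorem IsMetricOn.apply_inverse (hG : IsMetricOn G S) {y : E} (hy : y ∈ S) (φ : E →L[ℝ] ℝ) :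
    G y ((G y).inverse φ) = φ := by
  have h := (hG.isInvertible hy).self_comp_inverse
  exact congrArg (fun T : (E →L[ℝ] ℝ) →L[ℝ] (E →L[ℝ] ℝ) => T φ) h

theorem IsMetricOn.christoffel_smooth (hG : IsMetricOn G S) {y : E} (hy : y ∈ S) :
    ContDiffAt ℝ ∞ (christoffel G) y := by
  unfold christoffel
  refine ContDiffAt.const_smul _ (ContDiffAt.clm_comp ?_ (hG.koszul_smooth hy))
  exact (ContinuousLinearMap.contDiff _).contDiffAt.comp y
    ((hG.isInvertible hy).contDiffAt_map_inverse.comp y (hG.smooth y hy))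

theorem IsMetricOn.christoffelComp_smooth (hG : IsMetricOn G S) {y : E} (hy : y ∈ S) :
    ContDiffAt ℝ ∞ (christoffelComp G) y := by
  have h := hG.christoffel_smooth hy
  have h1 : ContDiffAt ℝ ∞
      (fun y => ((ContinuousLinearMap.compL ℝ E E E) ∘L christoffel G y)) y :=
    contDiffAt_const.clm_comp h
  have h2 := (h1.clm_flip.clm_comp h).clm_flip
  exact h2

theorem IsMetricOn.riemann_smooth (hG : IsMetricOn G S) {y : E} (hy : y ∈ S) :
    ContDiffAt ℝ ∞ (riemann G) y := by
  have h := (hG.christoffel_smooth hy).fderiv_smooth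
  have h2 := hG.christoffelComp_smooth hy
  exact (h.sub h.clm_flip).add (h2.sub h2.clm_flip)

/-- The trace as a continuous linear form. -/
def traceL (E : Type*) [NormedAddCommGroup E] [NormedSpace ℝ E] [FiniteDimensional ℝ E] :
    (E →L[ℝ] E) →L[ℝ] ℝ :=
  LinearMap.toContinuousLinearMap
    (LinearMap.trace ℝ E ∘ₗ (ContinuousLinearMap.coeLM ℝ : (E →L[ℝ] E) →ₗ[ℝ] (E →ₗ[ℝ] E)))

theorem traceL_apply (T : E →L[ℝ] E) : traceL E T = LinearMap.trace ℝ E (T : E →ₗ[ℝ] E) := rfl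

theorem traceL_comp_comm (A B : E →L[ℝ] E) : traceL E (A ∘L B) = traceL E (B ∘L A) :=
  LinearMap.trace_comp_comm' (A : E →ₗ[ℝ] E) (B : E →ₗ[ℝ] E) |>.symm ▸ rfl

/-- The Ricci form as a continuous bilinear form. -/
def ricciForm (G : E → E →L[ℝ] E →L[ℝ] ℝ) (y : E) : E →L[ℝ] E →L[ℝ] ℝ :=
  ContinuousLinearMap.compL ℝ E (E →L[ℝ] E) ℝ (traceL E) ∘L flipL E E E ∘L (riemann G y).flip

theorem ricciForm_apply (y a b : E) : ricciForm G y a b = ricci G y a b := rfl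

theorem ricci_eq_trace_jacobi (y x : E) : ricci G y x x = traceL E (jacobi G y x) := rfl

theorem IsMetricOn.ricciForm_smooth (hG : IsMetricOn G S) {y : E} (hy : y ∈ S) :
    ContDiffAt ℝ ∞ (ricciForm G) y :=
  contDiffAt_const.clm_comp (contDiffAt_const.clm_comp (hG.riemann_smooth hy).clm_flip)

/-- The covariant derivative `(x, a, b) ↦ (∇_x ric)(a,b)` as a trilinear form. -/
def covRicciForm (G : E → E →L[ℝ] E →L[ℝ] ℝ) (y : E) : E →L[ℝ] E →L[ℝ] E →L[ℝ] ℝ :=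
  fderiv ℝ (ricciForm G) y
    - ContinuousLinearMap.compL ℝ E E (E →L[ℝ] ℝ) (ricciForm G y) ∘L christoffel G y
    - flipL E E ℝ ∘L
      ContinuousLinearMap.compL ℝ E E (E →L[ℝ] ℝ) (ricciForm G y).flip ∘L christoffel G y

theorem covRicciForm_apply (y x a b : E) : covRicciForm G y x a b =
    fderiv ℝ (ricciForm G) y x a b - ricciForm G y (christoffel G y x a) b
      - ricciForm G y a (christoffel G y x b) := rfl

/-- Evaluation at fixed vectors commutes with differentiation in the base point. The form-valued
version can be differentiated along curves with moving arguments. -/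
theorem IsMetricOn.covRicci_eq (hG : IsMetricOn G S) {y : E} (hy : y ∈ S) (x a b : E) :
    covRicci G y x a b = covRicciForm G y x a b := by
  have h := (hG.ricciForm_smooth hy).differentiableAt_smooth.hasFDerivAt
  have h2 : HasFDerivAt (fun z => ricci G z a b) _ y :=
    (h.clm_apply (hasFDerivAt_const a y)).clm_apply (hasFDerivAt_const b y)
  rw [covRicci, covRicciForm_apply, h2.fderiv]
  simp [ricciForm_apply]

theorem IsMetricOn.covRicciForm_smooth (hG : IsMetricOn G S) {y : E} (hy : y ∈ S) :
    ContDiffAt ℝ ∞ (covRicciForm G) y := by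
  have h := hG.ricciForm_smooth hy
  have hc := hG.christoffel_smooth hy
  refine (h.fderiv_smooth.sub (ContDiffAt.clm_comp ?_ hc)).sub
    (contDiffAt_const.clm_comp (ContDiffAt.clm_comp ?_ hc))
  · exact (ContinuousLinearMap.contDiff _).contDiffAt.comp y h
  · exact (ContinuousLinearMap.contDiff _).contDiffAt.comp y h.clm_flip

theorem IsMetricOn.covRicci2_eq (hG : IsMetricOn G S) {y : E} (hy : y ∈ S) (w x a b : E) :
    covRicci2 G y w x a b = fderiv ℝ (covRicciForm G) y w x a b
      - covRicciForm G y (christoffel G y w x) a b - covRicciForm G y x (christoffel G y w a) b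
      - covRicciForm G y x a (christoffel G y w b) := by
  have h := (hG.covRicciForm_smooth hy).differentiableAt_smooth.hasFDerivAt
  have h2 := ((h.clm_apply (hasFDerivAt_const x y)).clm_apply
    (hasFDerivAt_const a y)).clm_apply (hasFDerivAt_const b y)
  have h3 : (fun z => covRicci G z x a b) =ᶠ[𝓝 y] fun z => covRicciForm G z x a b := by
    filter_upwards [hG.isOpen.mem_nhds hy] with z hz using hG.covRicci_eq hz x a b
  rw [covRicci2, h3.fderiv_eq, h2.fderiv]
  simp [hG.covRicci_eq hy]

/-- The Levi-Civita connection is metric. -/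
theorem IsMetricOn.fderiv_eq (hG : IsMetricOn G S) {y : E} (hy : y ∈ S) (v a b : E) :
    fderiv ℝ G y v a b = G y (christoffel G y v a) b + G y a (christoffel G y v b) := by
  have hsymm : ∀ z a b, fderiv ℝ G y z a b = fderiv ℝ G y z b a := by
    intro z a b
    have h := (hG.smooth y hy).differentiableAt_smooth.hasFDerivAt
    have h1 := (h.clm_apply (hasFDerivAt_const a y)).clm_apply (hasFDerivAt_const b y)
    have h2 := (h.clm_apply (hasFDerivAt_const b y)).clm_apply (hasFDerivAt_const a y)
    have h3 : (fun z => G z a b) =ᶠ[𝓝 y] fun z => G z b a := by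
      filter_upwards [hG.isOpen.mem_nhds hy] with z hz using hG.symm z hz a b
    have h4 := h1.unique (h2.congr_of_eventuallyEq h3)
    simpa using congrArg (fun T : E →L[ℝ] ℝ => T z) h4
  have key : ∀ a b, G y (christoffel G y v a) b = 1 / 2 * koszul G y v a b := by
    intro a b
    rw [christoffel_apply, map_smul, hG.apply_inverse hy]
    rfl
  -- In the sum of the two Koszul expressions the terms differentiated along `a` and `b` cancel, by
  -- the symmetry of the derivative of `G`.
  rw [hG.symm y hy a, key, key, koszul_apply, koszul_apply, hsymm v b a, hsymm a v b, hsymm b v a]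
  ring

/-- `R(x,x)` vanishes identically, hence so does its derivative, and the two Christoffel corrections
in the first two slots cancel by antisymmetry. -/
theorem derivedJacobi_self (hG : IsMetricOn G S) {y : E} (hy : y ∈ S) (x : E) :
    derivedJacobi G y x x = 0 := by
  have h := (hG.riemann_smooth hy).differentiableAt_smooth.hasFDerivAt
  have hanti : ∀ z a b, riemann G z a b = -riemann G z b a := by
    intro z a b
    ext c
    simp only [riemann_apply, neg_apply]
    abel
  have h1 := (h.clm_apply (hasFDerivAt_const x y)).clm_apply (hasFDerivAt_const x y)
  have h0 : (fun z => riemann G z x x) = fun _ => 0 := funext fun z => riemann_self z x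
  rw [h0] at h1
  have h2 : fderiv ℝ (riemann G) y x x x = 0 := by
    simpa using (congrArg (fun T : E →L[ℝ] E →L[ℝ] E => T x) (h1.unique (hasFDerivAt_const _ y)))
  change covRiemann G y x x x x = 0
  rw [covRiemann, h2, hanti y (christoffel G y x x) x]
  simp [riemann_self]

end Smoothness

end ChartCalculus

/-! ### Homogeneous polynomial maps and the curvature tensors as such -/

section HomogeneousPolynomials

/-- A map `f` from `E3` to a vector space is a homogeneous polynomial of degree `n` if all its
linear coordinates are homogeneous polynomials of degree `n`. -/
def IsHomPoly {W : Type*} [AddCommGroup W] [Module ℝ W] (n : ℕ) (f : E3 → W) : Prop :=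
  ∀ φ : W →ₗ[ℝ] ℝ, ∃ q : MvPolynomial (Fin 3) ℝ, q.IsHomogeneous n ∧
    ∀ x, φ (f x) = MvPolynomial.eval (fun i => x i) q

namespace IsHomPoly

variable {W W' W'' : Type*} [AddCommGroup W] [Module ℝ W] [AddCommGroup W'] [Module ℝ W']
  [AddCommGroup W''] [Module ℝ W''] {n m : ℕ}

theorem const (w : W) : IsHomPoly 0 (fun _ => w) := fun φ =>
  ⟨MvPolynomial.C (φ w), MvPolynomial.isHomogeneous_C _ _, fun x => by simp⟩

theorem linear {f : E3 → W} (hf : IsHomPoly n f) (L : W →ₗ[ℝ] W') :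
    IsHomPoly n (fun x => L (f x)) := fun φ => hf (φ ∘ₗ L)

theorem add {f h : E3 → W} (hf : IsHomPoly n f) (hh : IsHomPoly n h) :
    IsHomPoly n (fun x => f x + h x) := fun φ => by
  obtain ⟨q, hq, hq'⟩ := hf φ
  obtain ⟨r, hr, hr'⟩ := hh φ
  exact ⟨q + r, hq.add hr, fun x => by simp [hq', hr']⟩

theorem neg {f : E3 → W} (hf : IsHomPoly n f) : IsHomPoly n (fun x => -f x) :=
  hf.linear (-LinearMap.id)

theorem sub {f h : E3 → W} (hf : IsHomPoly n f) (hh : IsHomPoly n h) :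
    IsHomPoly n (fun x => f x - h x) := by
  simpa only [sub_eq_add_neg] using hf.add hh.neg

theorem const_mul {f : E3 → ℝ} (hf : IsHomPoly n f) (c : ℝ) : IsHomPoly n (fun x => c * f x) :=
  hf.linear (c • LinearMap.id)

theorem mul {f h : E3 → ℝ} (hf : IsHomPoly n f) (hh : IsHomPoly m h) :
    IsHomPoly (n + m) (fun x => f x * h x) := fun φ => by
  obtain ⟨q, hq, hq'⟩ := hf LinearMap.id
  obtain ⟨r, hr, hr'⟩ := hh LinearMap.id
  refine ⟨MvPolynomial.C (φ 1) * (q * r), ?_, fun x => ?_⟩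
  · simpa using (MvPolynomial.isHomogeneous_C _ (φ 1)).mul (hq.mul hr)
  · have h1 : φ (f x * h x) = f x * h x * φ 1 := by
      simpa using φ.map_smul (f x * h x) 1
    have h2 := hq' x
    have h3 := hr' x
    simp only [LinearMap.id_apply] at h2 h3
    rw [h1, h2, h3]
    simp only [map_mul, MvPolynomial.eval_C]
    ring

theorem sum {ι : Type*} (s : Finset ι) {f : ι → E3 → W} (hf : ∀ i ∈ s, IsHomPoly n (f i)) :
    IsHomPoly n (fun x => ∑ i ∈ s, f i x) := fun φ => by
  choose! q hq using fun i hi => hf i hi φ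
  refine ⟨∑ i ∈ s, q i, MvPolynomial.IsHomogeneous.sum _ _ _ fun i hi => (hq i hi).1, fun x => ?_⟩
  rw [map_sum, map_sum]
  exact Finset.sum_congr rfl fun i hi => (hq i hi).2 x

/-- Expansion in bases of both factors reduces to products of scalar coordinates. Evaluation and
composition of operators are instances. -/
theorem bilinear [FiniteDimensional ℝ W] [FiniteDimensional ℝ W'] {f : E3 → W} {h : E3 → W'}
    (hf : IsHomPoly n f) (hh : IsHomPoly m h) (B : W →ₗ[ℝ] W' →ₗ[ℝ] W'') :
    IsHomPoly (n + m) (fun x => B (f x) (h x)) := fun φ => by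
  let b := Module.finBasis ℝ W
  let b' := Module.finBasis ℝ W'
  have key : (fun x => φ (B (f x) (h x))) =
      fun x => ∑ i, ∑ j, φ (B (b i) (b' j)) * (b.coord i (f x) * b'.coord j (h x)) := by
    ext x
    conv_lhs => rw [← b.sum_repr (f x), ← b'.sum_repr (h x)]
    simp only [map_sum, LinearMap.sum_apply, map_smul, LinearMap.smul_apply, smul_eq_mul,
      Module.Basis.coord_apply]
    rw [Finset.sum_comm]
    refine Finset.sum_congr rfl fun i _ => ?_
    rw [Finset.mul_sum]
    exact Finset.sum_congr rfl fun j _ => by ring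
  have h1 : IsHomPoly (n + m) (fun x => φ (B (f x) (h x))) := by
    rw [key]
    exact sum _ fun i _ => sum _ fun j _ =>
      ((hf.linear (b.coord i)).mul (hh.linear (b'.coord j))).const_mul _
  exact h1 LinearMap.id

theorem id : IsHomPoly 1 (fun x : E3 => x) := fun φ => by
  refine ⟨∑ i, MvPolynomial.C (φ (EuclideanSpace.single i 1)) * MvPolynomial.X i,
    MvPolynomial.IsHomogeneous.sum _ _ _ fun i _ => ?_, fun x => ?_⟩
  · simpa using (MvPolynomial.isHomogeneous_C _ _).mul (MvPolynomial.isHomogeneous_X ℝ i)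
  · conv_lhs => rw [← (EuclideanSpace.basisFun (Fin 3) ℝ).sum_repr x]
    simp [mul_comm]

theorem clm_apply {V V' : Type*} [NormedAddCommGroup V] [NormedSpace ℝ V]
    [NormedAddCommGroup V'] [NormedSpace ℝ V'] [FiniteDimensional ℝ V] [FiniteDimensional ℝ V']
    {f : E3 → V →L[ℝ] V'} {h : E3 → V} (hf : IsHomPoly n f) (hh : IsHomPoly m h) :
    IsHomPoly (n + m) (fun x => f x (h x)) :=
  hf.bilinear hh (ContinuousLinearMap.coeLM ℝ)

theorem clm_comp {f h : E3 → E3 →L[ℝ] E3} (hf : IsHomPoly n f) (hh : IsHomPoly m h) :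
    IsHomPoly (n + m) (fun x => f x ∘L h x) :=
  hf.bilinear hh ((ContinuousLinearMap.coeLM ℝ) ∘ₗ
    (ContinuousLinearMap.compL ℝ E3 E3 E3).toLinearMap)

theorem clm_flip {V V' V'' : Type*} [NormedAddCommGroup V] [NormedSpace ℝ V]
    [NormedAddCommGroup V'] [NormedSpace ℝ V'] [NormedAddCommGroup V''] [NormedSpace ℝ V'']
    {f : E3 → V →L[ℝ] V' →L[ℝ] V''} (hf : IsHomPoly n f) :
    IsHomPoly n (fun x => (f x).flip) :=
  hf.linear (flipL V V' V'').toLinearMap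

theorem trace {f : E3 → E3 →L[ℝ] E3} (hf : IsHomPoly n f) :
    IsHomPoly n (fun x => traceL E3 (f x)) :=
  hf.linear (traceL E3 : (E3 →L[ℝ] E3) →ₗ[ℝ] ℝ)

/-- This scaling law carries an identity from unit vectors to all vectors. -/
theorem map_smul {f : E3 → ℝ} (hf : IsHomPoly n f) (c : ℝ) (x : E3) :
    f (c • x) = c ^ n * f x := by
  obtain ⟨q, hq, hq'⟩ := hf LinearMap.id
  have h1 := hq' (c • x)
  have h2 := hq' x
  simp only [LinearMap.id_apply] at h1 h2
  have h3 : (fun i => (c • x) i) = c • fun i => x i := rfl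
  rw [h1, h2, h3, MvPolynomial.eval_eq, MvPolynomial.eval_eq, Finset.mul_sum]
  refine Finset.sum_congr rfl fun d hd => ?_
  have hd' : ∑ i, d i = n := by
    have := hq (MvPolynomial.mem_support_iff.mp hd)
    rw [Finsupp.weight_apply, Finsupp.sum_fintype _ _ (by simp)] at this
    simpa using this
  have h4 : ∏ i, (c • fun i => x i) i ^ d i = c ^ n * ∏ i, x i ^ d i := by
    simp only [Pi.smul_apply, smul_eq_mul, mul_pow, Finset.prod_mul_distrib, ← hd',
      Finset.prod_pow_eq_pow_sum]
  have hp : ∀ y : Fin 3 → ℝ, ∏ i ∈ d.support, y i ^ d i = ∏ i, y i ^ d i := fun y =>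
    Finset.prod_subset (Finset.subset_univ _) fun i _ hi => by
      rw [Finsupp.notMem_support_iff.mp hi, pow_zero]
  rw [hp, hp, h4]
  ring

theorem isHomogeneousPolynomial {V : Type*} [AddCommGroup V] [Module ℝ V] {f : E3 → ℝ}
    (hf : IsHomPoly n f) (e : V ≃ₗ[ℝ] E3) : IsHomogeneousPolynomial n (fun X => f (e X)) := by
  obtain ⟨q, hq, hq'⟩ := hf LinearMap.id
  exact ⟨(EuclideanSpace.basisFun (Fin 3) ℝ).toBasis.map e.symm, q, hq, fun X => by
    simpa using hq' (e X)⟩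

end IsHomPoly

section Curvature

variable {G : E3 → E3 →L[ℝ] E3 →L[ℝ] ℝ} (y : E3)

theorem isHomPoly_jacobi : IsHomPoly 2 (fun x => jacobi G y x) :=
  ((IsHomPoly.const (riemann G y)).clm_flip.clm_apply .id).clm_flip.clm_apply .id

theorem isHomPoly_christoffel : IsHomPoly 1 (fun x => christoffel G y x) :=
  (IsHomPoly.const (christoffel G y)).clm_apply .id

theorem isHomPoly_derivedJacobiL : IsHomPoly 3 (fun x => derivedJacobiL G y x) := by
  have hJ := isHomPoly_jacobi (G := G) y
  have hC := isHomPoly_christoffel (G := G) y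
  have hC2 := hC.clm_apply .id
  have hR := (IsHomPoly.const (riemann G y)).clm_flip
  have hD := (IsHomPoly.const (fderiv ℝ (riemann G) y)).clm_apply .id
  exact ((((hD.clm_flip.clm_apply .id).clm_flip.clm_apply .id).add (hC.clm_comp hJ)).sub
    (hJ.clm_comp hC)).sub ((hR.clm_apply hC2).clm_flip.clm_apply .id) |>.sub
    ((hR.clm_apply .id).clm_flip.clm_apply hC2)

theorem isHomPoly_covRicciForm : IsHomPoly 3 (fun x => covRicciForm G y x x x) :=
  (((IsHomPoly.const (covRicciForm G y)).clm_apply .id).clm_apply .id).clm_apply .id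

variable {S : Set E3} {y}

theorem IsMetricOn.isHomPoly_covRicci2 (hG : IsMetricOn G S) (hy : y ∈ S) :
    IsHomPoly 4 (fun x => covRicci2 G y x x x x) := by
  simp only [hG.covRicci2_eq hy]
  have hC2 := (isHomPoly_christoffel (G := G) y).clm_apply .id
  have hR := IsHomPoly.const (covRicciForm G y)
  have hD := IsHomPoly.const (fderiv ℝ (covRicciForm G) y)
  exact ((((((hD.clm_apply .id).clm_apply .id).clm_apply .id).clm_apply .id).sub
    (((hR.clm_apply hC2).clm_apply .id).clm_apply .id)).sub
    (((hR.clm_apply .id).clm_apply hC2).clm_apply .id)).sub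
    (((hR.clm_apply .id).clm_apply .id).clm_apply hC2)

end Curvature

end HomogeneousPolynomials

/-! ### Trace identities in dimensions two and three -/

section LinearAlgebra

/-- By Cayley–Hamilton a trace-free `C` on a plane satisfies `C² = -det C`; take traces. It replaces
a determinant on the varying plane `X^⊥` by a trace. -/
theorem LinearMap.det_eq_of_trace_eq_zero {V : Type*} [AddCommGroup V] [Module ℝ V]
    (hV : Module.finrank ℝ V = 2) (C : V →ₗ[ℝ] V) (hC : LinearMap.trace ℝ V C = 0) :
    LinearMap.det C = -(1 / 2) * LinearMap.trace ℝ V (C ∘ₗ C) := by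
  have : FiniteDimensional ℝ V := Module.finite_of_finrank_eq_succ hV
  let b := Module.finBasisOfFinrankEq ℝ V hV
  rw [LinearMap.trace_eq_matrix_trace ℝ b] at hC ⊢
  rw [LinearMap.toMatrix_comp b b b, ← LinearMap.det_toMatrix b]
  simp only [Matrix.trace_fin_two, Matrix.det_fin_two, Matrix.mul_apply, Fin.sum_univ_two] at hC ⊢
  have h : LinearMap.toMatrix b b C 1 1 = -LinearMap.toMatrix b b C 0 0 := by linarith
  rw [h]
  ring

/-- For trace-free `U` in dimension 3, `tr U³ = 3 det U`, and a kernel vector makes the determinant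
vanish. -/
theorem LinearMap.trace_comp_comp_self_eq {V : Type*} [AddCommGroup V] [Module ℝ V]
    (hV : Module.finrank ℝ V = 3) (U : V →ₗ[ℝ] V) (hU : LinearMap.trace ℝ V U = 0)
    {v : V} (hv : v ≠ 0) (hUv : U v = 0) :
    LinearMap.trace ℝ V (U ∘ₗ U ∘ₗ U) = 0 := by
  have : FiniteDimensional ℝ V := Module.finite_of_finrank_eq_succ hV
  have hdet : LinearMap.det U = 0 := by
    by_contra h
    exact hv ((LinearEquiv.ofIsUnitDet (f := U) (v := Module.finBasis ℝ V)
      (v' := Module.finBasis ℝ V) (by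
        rw [LinearMap.det_toMatrix]; exact isUnit_iff_ne_zero.mpr h)).injective (by simp [hUv]))
  let b := Module.finBasisOfFinrankEq ℝ V hV
  rw [LinearMap.trace_eq_matrix_trace ℝ b] at hU ⊢
  rw [LinearMap.toMatrix_comp b b b, LinearMap.toMatrix_comp b b b]
  rw [← LinearMap.det_toMatrix b] at hdet
  generalize LinearMap.toMatrix b b U = A at *
  simp only [Matrix.trace_fin_three, Matrix.det_fin_three, Matrix.mul_apply,
    Fin.sum_univ_three] at hU hdet ⊢
  have h : A 2 2 = -A 0 0 - A 1 1 := by linarith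
  rw [h] at hdet ⊢
  linear_combination 3 * hdet

variable {V : Type*} [AddCommGroup V] [Module ℝ V]

/-- A unit vector is the first vector of an orthonormal basis. -/
theorem exists_orthonormal_basis_of_unit (hV : Module.finrank ℝ V = 3) (B : V →ₗ[ℝ] V →ₗ[ℝ] ℝ)
    (hsymm : ∀ v w, B v w = B w v) (hpos : ∀ v, v ≠ 0 → 0 < B v v) {x : V} (hx : B x x = 1) :
    ∃ b : Module.Basis (Fin 3) ℝ V, b 0 = x ∧ ∀ v i, b.repr v i = B (b i) v := by
  have : FiniteDimensional ℝ V := Module.finite_of_finrank_eq_succ hV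
  let c : InnerProductSpace.Core ℝ V :=
    { inner v w := B v w
      conj_inner_symm v w := hsymm w v
      re_inner_nonneg v := by
        rcases eq_or_ne v 0 with rfl | hv
        · simp
        · simpa using (hpos v hv).le
      add_left v w x := by simp
      smul_left c v := by simp
      definite v h := by contrapose! h; exact (hpos v h).ne' }
  let _ : NormedAddCommGroup V := c.toNormedAddCommGroup
  let _ : InnerProductSpace ℝ V := InnerProductSpace.ofCore c.toCore
  have hxn : ‖x‖ = 1 := by
    have h : inner ℝ x x = (1 : ℝ) := hx
    rw [real_inner_self_eq_norm_sq] at h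
    nlinarith [norm_nonneg x]
  -- The one-element family `x`, indexed by `{0}`, is extended to an orthonormal basis, so that `x`
  -- lands at index `0`.
  have ho : Orthonormal ℝ (Set.domRestrict ({0} : Set (Fin 3)) (fun _ => x)) := by
    refine ⟨fun i => hxn, fun i j hij => ?_⟩
    exact absurd (Subsingleton.elim i j) hij
  obtain ⟨b, hb⟩ := ho.exists_orthonormalBasis_extension_of_card_eq (by simpa using hV)
  refine ⟨b.toBasis, by simpa using hb 0 rfl, fun v i => ?_⟩
  rw [OrthonormalBasis.coe_toBasis_repr_apply, OrthonormalBasis.repr_apply_apply,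
    OrthonormalBasis.coe_toBasis]
  rfl

/-- Let `J`, `K`, `U` be symmetric and annihilate the unit vector `x`, with `U` trace-free. Then
`U` acts on the complement of `x` as a trace-free symmetric matrix and its scalar products with
`J` and `K` satisfy an algebraic relation. -/
theorem trace_relation_of_symmetric (hV : Module.finrank ℝ V = 3) (B : V →ₗ[ℝ] V →ₗ[ℝ] ℝ)
    (hsymm : ∀ v w, B v w = B w v) (hpos : ∀ v, v ≠ 0 → 0 < B v v) {x : V} (hx : B x x = 1)
    {J K U : V →ₗ[ℝ] V} (hJ : ∀ v w, B (J v) w = B v (J w)) (hK : ∀ v w, B (K v) w = B v (K w))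
    (hU : ∀ v w, B (U v) w = B v (U w)) (hJx : J x = 0) (hKx : K x = 0) (hUx : U x = 0)
    (hU0 : LinearMap.trace ℝ V U = 0) :
    LinearMap.trace ℝ V (U ∘ₗ U ∘ₗ J) =
        1 / 2 * LinearMap.trace ℝ V (U ∘ₗ U) * LinearMap.trace ℝ V J ∧
      ((LinearMap.trace ℝ V (J ∘ₗ J) - 1 / 2 * LinearMap.trace ℝ V J ^ 2) *
            (2 * LinearMap.trace ℝ V (U ∘ₗ K)) -
          (LinearMap.trace ℝ V (J ∘ₗ K) -
            1 / 2 * LinearMap.trace ℝ V J * LinearMap.trace ℝ V K) *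
            (2 * LinearMap.trace ℝ V (U ∘ₗ J))) ^ 2 =
        -(1 / 2) * LinearMap.trace ℝ V ((J ∘ₗ K - K ∘ₗ J) ∘ₗ (J ∘ₗ K - K ∘ₗ J)) *
          (-(2 * LinearMap.trace ℝ V (U ∘ₗ J)) ^ 2 +
            4 * (LinearMap.trace ℝ V (J ∘ₗ J) - 1 / 2 * LinearMap.trace ℝ V J ^ 2) *
              LinearMap.trace ℝ V (U ∘ₗ U)) := by
  have : FiniteDimensional ℝ V := Module.finite_of_finrank_eq_succ hV
  obtain ⟨b, rfl, hb⟩ := exists_orthonormal_basis_of_unit hV B hsymm hpos hx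
  -- In an orthonormal basis starting with `x`, a symmetric operator that kills `x` is a symmetric
  -- 2×2 block bordered by zeros.
  have hM : ∀ T : V →ₗ[ℝ] V, (∀ v w, B (T v) w = B v (T w)) → T (b 0) = 0 →
      (∀ i, LinearMap.toMatrix b b T i 0 = 0) ∧ (∀ i, LinearMap.toMatrix b b T 0 i = 0) ∧
        LinearMap.toMatrix b b T 2 1 = LinearMap.toMatrix b b T 1 2 := by
    intro T hT hT0
    have hs : ∀ i j, LinearMap.toMatrix b b T i j = LinearMap.toMatrix b b T j i := by
      intro i j
      rw [LinearMap.toMatrix_apply, LinearMap.toMatrix_apply, hb, hb, ← hT, hsymm]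
    have h0 : ∀ i, LinearMap.toMatrix b b T i 0 = 0 := fun i => by
      simp [LinearMap.toMatrix_apply, hT0]
    exact ⟨h0, fun i => (hs 0 i).trans (h0 i), hs 2 1⟩
  obtain ⟨hJ1, hJ2, hJ3⟩ := hM J hJ hJx
  obtain ⟨hK1, hK2, hK3⟩ := hM K hK hKx
  obtain ⟨hU1, hU2, hU3⟩ := hM U hU hUx
  simp only [LinearMap.trace_eq_matrix_trace ℝ b, LinearMap.toMatrix_comp b b b, map_sub] at hU0 ⊢
  generalize LinearMap.toMatrix b b J = MJ at *
  generalize LinearMap.toMatrix b b K = MK at *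
  generalize LinearMap.toMatrix b b U = MU at *
  simp only [Matrix.trace_fin_three, Matrix.mul_apply, Matrix.sub_apply, Fin.sum_univ_three, hJ1,
    hJ2, hJ3, hK1, hK2, hK3, hU1, hU2, hU3, mul_zero, zero_mul, zero_add, add_zero, sub_zero]
    at hU0 ⊢
  have h : MU 2 2 = -MU 1 1 := by linarith
  rw [h]
  -- What remains are polynomial identities in the block entries: `U² = ½ tr(U²)` on the plane, and
  -- the Gram identity for three vectors in the 2-dimensional space of trace-free symmetric
  -- matrices.
  constructor <;> ring

end LinearAlgebra

/-! ### From endomorphisms of the orthogonal complement to traces on the tangent space -/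

section Perp

variable {M : Type*} [TopologicalSpace M] [ChartedSpace E3 M]

instance tangentSpace_finiteDimensional (p : M) :
    FiniteDimensional ℝ (TangentSpace (𝓡 3) p) :=
  inferInstanceAs (FiniteDimensional ℝ E3)

theorem finrank_tangentSpace (p : M) : Module.finrank ℝ (TangentSpace (𝓡 3) p) = 3 :=
  finrank_euclideanSpace_fin (𝕜 := ℝ) (n := 3)

variable [IsManifold (𝓡 3) ∞ M] (g : RiemannianMetric3 M) (p : M) {X : TangentSpace (𝓡 3) p}

theorem coe_onPerp (f : TangentSpace (𝓡 3) p →ₗ[ℝ] TangentSpace (𝓡 3) p) (Y : perp g p X) :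
    (onPerp g p X f Y : TangentSpace (𝓡 3) p) =
      f Y - (g.inner p X (f Y) / g.inner p X X) • X := rfl

/-- The projection applied after `h` changes its value by a multiple of `X`, which `f` does not see.
Hence no invariance of `X^⊥` is needed. -/
theorem onPerp_comp {f : TangentSpace (𝓡 3) p →ₗ[ℝ] TangentSpace (𝓡 3) p} (hf : f X = 0)
    (h : TangentSpace (𝓡 3) p →ₗ[ℝ] TangentSpace (𝓡 3) p) :
    onPerp g p X f ∘ₗ onPerp g p X h = onPerp g p X (f ∘ₗ h) := by
  ext Y
  simp [coe_onPerp, hf]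

theorem onPerp_sub (f h : TangentSpace (𝓡 3) p →ₗ[ℝ] TangentSpace (𝓡 3) p) :
    onPerp g p X (f - h) = onPerp g p X f - onPerp g p X h := by
  ext Y
  simp only [coe_onPerp, LinearMap.sub_apply, Submodule.coe_sub, map_sub, sub_div, sub_smul]
  abel

/-- With `π` the projection and `ι` the inclusion, `tr(π f ι) = tr(f ι π)` by cyclicity, and `f ι π
= f` since `f` kills `X`. -/
theorem trace_onPerp {f : TangentSpace (𝓡 3) p →ₗ[ℝ] TangentSpace (𝓡 3) p} (hf : f X = 0) :
    LinearMap.trace ℝ (perp g p X) (onPerp g p X f) = LinearMap.trace ℝ _ f := by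
  let π : TangentSpace (𝓡 3) p →ₗ[ℝ] perp g p X :=
    { toFun := fun Z => ⟨Z - (g.inner p X Z / g.inner p X X) • X, sub_proj_mem_perp g p X Z⟩
      map_add' := fun Y Z => by
        ext1
        simp only [Submodule.coe_add, map_add, add_div, add_smul]
        abel
      map_smul' := fun a Y => by
        ext1
        simp only [Submodule.coe_smul, map_smul, smul_eq_mul, mul_div_assoc, mul_smul, smul_sub,
          RingHom.id_apply] }
  have h1 : onPerp g p X f = π ∘ₗ (f ∘ₗ (perp g p X).subtype) := rfl
  rw [h1, LinearMap.trace_comp_comm']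
  congr 1
  ext Z
  simp [π, hf]

theorem finrank_perp (hX : X ≠ 0) : Module.finrank ℝ (perp g p X) = 2 := by
  have h := LinearMap.finrank_range_add_finrank_ker
    (g.inner p X : TangentSpace (𝓡 3) p →ₗ[ℝ] ℝ)
  have hs : Function.Surjective (g.inner p X : TangentSpace (𝓡 3) p →ₗ[ℝ] ℝ) :=
    LinearMap.surjective fun h0 => (g.pos p X hX).ne' (LinearMap.congr_fun h0 X)
  rw [LinearMap.range_eq_top.mpr hs, finrank_top, finrank_tangentSpace, Module.finrank_self] at h
  change Module.finrank ℝ (LinearMap.ker (g.inner p X : TangentSpace (𝓡 3) p →ₗ[ℝ] ℝ)) = 2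
  omega

variable {f h : TangentSpace (𝓡 3) p →ₗ[ℝ] TangentSpace (𝓡 3) p}

theorem ringPart_eq (hf : f X = 0) : ringPart g p X f =
    onPerp g p X f - (1 / 2 * LinearMap.trace ℝ _ f) • LinearMap.id := by
  rw [ringPart, trace_onPerp g p hf]

/-- `X ≠ 0` makes the identity of `X^⊥` have trace 2, so the three correction terms add up to `-½ tr
f tr h`. -/
theorem trace_ringPart_comp (hX : X ≠ 0) (hf : f X = 0) (hh : h X = 0) :
    LinearMap.trace ℝ (perp g p X) (ringPart g p X f ∘ₗ ringPart g p X h) =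
      LinearMap.trace ℝ _ (f ∘ₗ h) -
        1 / 2 * LinearMap.trace ℝ _ f * LinearMap.trace ℝ _ h := by
  have hfh : (f ∘ₗ h) X = 0 := by simp [hh]
  rw [ringPart_eq g p hf, ringPart_eq g p hh, LinearMap.sub_comp, LinearMap.comp_sub,
    LinearMap.comp_sub, onPerp_comp g p hf]
  simp only [LinearMap.smul_comp, LinearMap.comp_smul, LinearMap.id_comp, LinearMap.comp_id,
    map_sub, map_smul, trace_onPerp g p hf, trace_onPerp g p hh, trace_onPerp g p hfh,
    LinearMap.trace_id, finrank_perp g p hX, smul_eq_mul]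
  ring

/-- Scalar parts drop out of the commutator, which is trace-free on a plane, so its determinant is
minus half the trace of its square. -/
theorem det_ringPart_commutator (hX : X ≠ 0) (hf : f X = 0) (hh : h X = 0) :
    LinearMap.det (ringPart g p X f ∘ₗ ringPart g p X h - ringPart g p X h ∘ₗ ringPart g p X f) =
      -(1 / 2) * LinearMap.trace ℝ _ ((f ∘ₗ h - h ∘ₗ f) ∘ₗ (f ∘ₗ h - h ∘ₗ f)) := by
  have hC : (f ∘ₗ h - h ∘ₗ f) X = 0 := by simp [hf, hh]
  have hCC : ((f ∘ₗ h - h ∘ₗ f) ∘ₗ (f ∘ₗ h - h ∘ₗ f)) X = 0 := by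
    rw [LinearMap.comp_apply, hC, map_zero]
  have key : ringPart g p X f ∘ₗ ringPart g p X h - ringPart g p X h ∘ₗ ringPart g p X f =
      onPerp g p X (f ∘ₗ h - h ∘ₗ f) := by
    rw [ringPart_eq g p hf, ringPart_eq g p hh, onPerp_sub, ← onPerp_comp g p hf,
      ← onPerp_comp g p hh]
    generalize 1 / 2 * LinearMap.trace ℝ _ f = c, 1 / 2 * LinearMap.trace ℝ _ h = d
    simp only [LinearMap.sub_comp, LinearMap.comp_sub, LinearMap.smul_comp, LinearMap.comp_smul,
      LinearMap.id_comp, LinearMap.comp_id]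
    module
  rw [key, LinearMap.det_eq_of_trace_eq_zero (finrank_perp g p hX), onPerp_comp g p hC,
    trace_onPerp g p hCC]
  rw [trace_onPerp g p hC, map_sub, LinearMap.trace_comp_comm', sub_self]

end Perp

/-! ### Riccati solutions along a geodesic -/

section AlongGeodesic

variable {E : Type*} [NormedAddCommGroup E] [NormedSpace ℝ E]

theorem HasDerivAt.clm_flip {F W : Type*} [NormedAddCommGroup F] [NormedSpace ℝ F]
    [NormedAddCommGroup W] [NormedSpace ℝ W] {f : ℝ → E →L[ℝ] F →L[ℝ] W}
    {f' : E →L[ℝ] F →L[ℝ] W} {t : ℝ} (hf : HasDerivAt f f' t) :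
    HasDerivAt (fun s => (f s).flip) f'.flip t :=
  (flipL E F W).hasFDerivAt.comp_hasDerivAt t hf

variable [FiniteDimensional ℝ E] {G : E → E →L[ℝ] E →L[ℝ] ℝ} {S : Set E} {c V : ℝ → E} {t : ℝ}

/-- The terms from `V' = -Γ(V,V)` are exactly the corrections of `∇R` in the slots filled by `V`;
only the commutator with `Γ` is left over. -/
theorem IsMetricOn.hasDerivAt_jacobi (hG : IsMetricOn G S) (hct : c t ∈ S)
    (hc : HasDerivAt c (V t) t) (hV : HasDerivAt V (-christoffel G (c t) (V t) (V t)) t) :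
    HasDerivAt (fun s => jacobi G (c s) (V s))
      (derivedJacobiL G (c t) (V t) - christoffel G (c t) (V t) ∘L jacobi G (c t) (V t)
        + jacobi G (c t) (V t) ∘L christoffel G (c t) (V t)) t := by
  have hR := (hG.riemann_smooth hct).differentiableAt_smooth.hasFDerivAt.comp_hasDerivAt t hc
  have h := (hR.clm_flip.clm_apply hV).clm_flip.clm_apply hV
  refine h.congr_deriv ?_
  ext z
  simp only [derivedJacobiL, jacobi, Function.comp_apply, add_apply, sub_apply, map_neg,
    ContinuousLinearMap.flip_apply, neg_apply, ContinuousLinearMap.comp_apply]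
  abel

theorem IsMetricOn.hasDerivAt_ricci (hG : IsMetricOn G S) (hct : c t ∈ S)
    (hc : HasDerivAt c (V t) t) (hV : HasDerivAt V (-christoffel G (c t) (V t) (V t)) t) :
    HasDerivAt (fun s => ricci G (c s) (V s) (V s))
      (covRicciForm G (c t) (V t) (V t) (V t)) t := by
  have hR := (hG.ricciForm_smooth hct).differentiableAt_smooth.hasFDerivAt.comp_hasDerivAt t hc
  refine ((hR.clm_apply hV).clm_apply hV).congr_deriv ?_
  simp only [covRicciForm_apply, Function.comp_apply, add_apply, map_neg, neg_apply]
  ring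

theorem IsMetricOn.hasDerivAt_covRicciForm (hG : IsMetricOn G S) (hct : c t ∈ S)
    (hc : HasDerivAt c (V t) t) (hV : HasDerivAt V (-christoffel G (c t) (V t) (V t)) t) :
    HasDerivAt (fun s => covRicciForm G (c s) (V s) (V s) (V s))
      (covRicci2 G (c t) (V t) (V t) (V t) (V t)) t := by
  have hR :=
    (hG.covRicciForm_smooth hct).differentiableAt_smooth.hasFDerivAt.comp_hasDerivAt t hc
  refine (((hR.clm_apply hV).clm_apply hV).clm_apply hV).congr_deriv ?_
  rw [hG.covRicci2_eq hct]
  simp only [Function.comp_apply, add_apply, map_neg, neg_apply]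
  ring

/-- The covariant derivative along a curve of a field of symmetric endomorphisms is symmetric. -/
theorem IsMetricOn.symmetric_covDeriv (hG : IsMetricOn G S) (hct : c t ∈ S)
    (hc : HasDerivAt c (V t) t) {A : ℝ → E →L[ℝ] E} {A' : E →L[ℝ] E} (hA : HasDerivAt A A' t)
    (hsymm : ∀ᶠ s in 𝓝 t, ∀ x y, G (c s) (A s x) y = G (c s) x (A s y)) (x y : E) :
    G (c t) ((A' + christoffel G (c t) (V t) ∘L A t - A t ∘L christoffel G (c t) (V t)) x) y =
      G (c t) x ((A' + christoffel G (c t) (V t) ∘L A t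
        - A t ∘L christoffel G (c t) (V t)) y) := by
  have hGt := (hG.smooth _ hct).differentiableAt_smooth.hasFDerivAt.comp_hasDerivAt t hc
  have hx := hasDerivAt_const t x
  have hy := hasDerivAt_const t y
  have h1 := (hGt.clm_apply (hA.clm_apply hx)).clm_apply hy
  have h2 := (hGt.clm_apply hx).clm_apply (hA.clm_apply hy)
  have h3 := h1.unique (h2.congr_of_eventuallyEq (by
    filter_upwards [hsymm] with s hs using hs x y))
  simp only [Function.comp_apply, add_apply, map_zero, add_zero,
    hG.fderiv_eq hct] at h3
  have hs := hsymm.self_of_nhds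
  have e1 := hs x (christoffel G (c t) (V t) y)
  -- Metric compatibility turns the derivative of `G` into Christoffel terms; symmetry of `A` moves
  -- those to the required side.
  have e2 := hs (christoffel G (c t) (V t) x) y
  simp only [add_apply, sub_apply, map_add, map_sub, ContinuousLinearMap.comp_apply]
  linarith

/-- A trace-free symmetric solution of the Riccati equation along a geodesic that annihilates the
velocity. -/
structure IsRiccatiAlong (G : E → E →L[ℝ] E →L[ℝ] ℝ) (S : Set E) (I : Set ℝ) (c V : ℝ → E)
    (U U' : ℝ → E →L[ℝ] E) : Prop where
  isOpen : IsOpen I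
  mem : ∀ t ∈ I, c t ∈ S
  hasDerivAt : ∀ t ∈ I, HasDerivAt c (V t) t
  geodesic : ∀ t ∈ I, HasDerivAt V (-christoffel G (c t) (V t) (V t)) t
  ne_zero : ∀ t ∈ I, V t ≠ 0
  hasDerivAt_endo : ∀ t ∈ I, HasDerivAt U (U' t) t
  riccati : ∀ t ∈ I, U' t + christoffel G (c t) (V t) ∘L U t - U t ∘L christoffel G (c t) (V t)
    + U t ∘L U t + jacobi G (c t) (V t) = 0
  symmetric : ∀ t ∈ I, ∀ x y, G (c t) (U t x) y = G (c t) x (U t y)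
  traceFree : ∀ t ∈ I, traceL E (U t) = 0
  velocity : ∀ t ∈ I, U t (V t) = 0

namespace IsRiccatiAlong

variable {I : Set ℝ} {U U' : ℝ → E →L[ℝ] E}

theorem deriv_eq (h : IsRiccatiAlong G S I c V U U') (ht : t ∈ I) :
    U' t = U t ∘L christoffel G (c t) (V t) - christoffel G (c t) (V t) ∘L U t
      - U t ∘L U t - jacobi G (c t) (V t) := by
  have h0 := h.riccati t ht
  rw [← sub_eq_zero, ← h0]
  abel

/-- The Riccati equation writes `J` as minus the sum of `u'` and `u²`, both symmetric. The pair
symmetry of the curvature tensor is thus not needed. -/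
theorem jacobi_symmetric (h : IsRiccatiAlong G S I c V U U') (hG : IsMetricOn G S) (ht : t ∈ I)
    (x y : E) : G (c t) (jacobi G (c t) (V t) x) y = G (c t) x (jacobi G (c t) (V t) y) := by
  have h1 := hG.symmetric_covDeriv (h.mem t ht) (h.hasDerivAt t ht) (h.hasDerivAt_endo t ht)
    (by filter_upwards [h.isOpen.mem_nhds ht] with s hs using h.symmetric s hs) x y
  have h2 : U' t + christoffel G (c t) (V t) ∘L U t - U t ∘L christoffel G (c t) (V t)
      = -(U t ∘L U t) - jacobi G (c t) (V t) := by
    rw [h.deriv_eq ht]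
    abel
  rw [h2] at h1
  have h3 := h.symmetric t ht (U t x) y
  have h4 := h.symmetric t ht x (U t y)
  simp only [sub_apply, neg_apply, ContinuousLinearMap.comp_apply, map_sub, map_neg] at h1
  linarith

/-- `J'` is the covariant derivative of the symmetric field `J` along the geodesic. -/
theorem derivedJacobi_symmetric (h : IsRiccatiAlong G S I c V U U') (hG : IsMetricOn G S)
    (ht : t ∈ I) (x y : E) :
    G (c t) (derivedJacobiL G (c t) (V t) x) y = G (c t) x (derivedJacobiL G (c t) (V t) y) := by
  have h1 := hG.symmetric_covDeriv (h.mem t ht) (h.hasDerivAt t ht)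
    (hG.hasDerivAt_jacobi (h.mem t ht) (h.hasDerivAt t ht) (h.geodesic t ht))
    (by filter_upwards [h.isOpen.mem_nhds ht] with s hs using h.jacobi_symmetric hG hs) x y
  simpa only [sub_add_cancel, sub_add_eq_add_sub, add_sub_cancel_right] using h1

theorem trace_deriv (h : IsRiccatiAlong G S I c V U U') (ht : t ∈ I) : traceL E (U' t) = 0 := by
  have h1 := (traceL E).hasFDerivAt.comp_hasDerivAt t (h.hasDerivAt_endo t ht)
  refine h1.unique ((hasDerivAt_const t (0 : ℝ)).congr_of_eventuallyEq ?_)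
  filter_upwards [h.isOpen.mem_nhds ht] with s hs using h.traceFree s hs

theorem trace_sq (h : IsRiccatiAlong G S I c V U U') (ht : t ∈ I) :
    traceL E (U t ∘L U t) = -ricci G (c t) (V t) (V t) := by
  have h1 := congrArg (traceL E) (h.riccati t ht)
  simp only [map_add, map_sub, map_zero, h.trace_deriv ht,
    traceL_comp_comm (U t) (christoffel G (c t) (V t))] at h1
  rw [ricci_eq_trace_jacobi]
  linarith

/-- Cyclicity shifts the commutator with `Γ` from `U` to `A`, where it cancels against the
correction in the derivative of `A`. -/
theorem trace_deriv_comp (h : IsRiccatiAlong G S I c V U U') (ht : t ∈ I) (A : E →L[ℝ] E) :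
    traceL E (U' t ∘L A) = traceL E (U t ∘L (christoffel G (c t) (V t) ∘L A
      - A ∘L christoffel G (c t) (V t))) - traceL E (U t ∘L U t ∘L A)
      - traceL E (jacobi G (c t) (V t) ∘L A) := by
  rw [h.deriv_eq ht]
  simp only [ContinuousLinearMap.sub_comp, ContinuousLinearMap.comp_sub, map_sub,
    ContinuousLinearMap.comp_assoc]
  rw [traceL_comp_comm (christoffel G (c t) (V t)) (U t ∘L A), ContinuousLinearMap.comp_assoc]

/-- Derivative of `tr U² = -ric` along the geodesic, with `U'` eliminated by the Riccati equation
and `tr U³ = 0`. -/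
theorem trace_comp_jacobi (h : IsRiccatiAlong G S I c V U U') (hG : IsMetricOn G S)
    (hE : Module.finrank ℝ E = 3) (ht : t ∈ I) :
    2 * traceL E (U t ∘L jacobi G (c t) (V t)) = covRicciForm G (c t) (V t) (V t) (V t) := by
  have hU := h.hasDerivAt_endo t ht
  have h1 := (traceL E).hasFDerivAt.comp_hasDerivAt t (hU.clm_comp hU)
  have h2 := h1.unique
    ((hG.hasDerivAt_ricci (h.mem t ht) (h.hasDerivAt t ht)
      (h.geodesic t ht)).neg.congr_of_eventuallyEq
      (by filter_upwards [h.isOpen.mem_nhds ht] with s hs using h.trace_sq hs))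
  have h3 : traceL E (U t ∘L U t ∘L U t) = 0 :=
    LinearMap.trace_comp_comp_self_eq hE (U t) (h.traceFree t ht) (h.ne_zero t ht)
      (h.velocity t ht)
  rw [map_add, traceL_comp_comm (U t) (U' t), h.trace_deriv_comp ht, h3,
    traceL_comp_comm (jacobi G (c t) (V t))] at h2
  have h4 : traceL E (U t ∘L (christoffel G (c t) (V t) ∘L U t
      - U t ∘L christoffel G (c t) (V t))) = 0 := by
    rw [ContinuousLinearMap.comp_sub, map_sub, ← ContinuousLinearMap.comp_assoc,
      traceL_comp_comm (U t ∘L christoffel G (c t) (V t)), sub_self]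
  rw [h4] at h2
  linarith

/-- Derivative of `2 tr(UJ) = (∇ ric)(V,V,V)`, again with `U'` eliminated by the Riccati equation.
-/
theorem trace_comp_derivedJacobi (h : IsRiccatiAlong G S I c V U U') (hG : IsMetricOn G S)
    (hE : Module.finrank ℝ E = 3) (ht : t ∈ I) :
    2 * traceL E (U t ∘L derivedJacobiL G (c t) (V t)) =
      2 * traceL E (U t ∘L U t ∘L jacobi G (c t) (V t))
        + 2 * traceL E (jacobi G (c t) (V t) ∘L jacobi G (c t) (V t))
        + covRicci2 G (c t) (V t) (V t) (V t) (V t) := by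
  have hJ := hG.hasDerivAt_jacobi (h.mem t ht) (h.hasDerivAt t ht) (h.geodesic t ht)
  have h1 := ((traceL E).hasFDerivAt.comp_hasDerivAt t
    ((h.hasDerivAt_endo t ht).clm_comp hJ)).const_mul 2
  have h2 := h1.unique
    ((hG.hasDerivAt_covRicciForm (h.mem t ht) (h.hasDerivAt t ht)
      (h.geodesic t ht)).congr_of_eventuallyEq
      (by filter_upwards [h.isOpen.mem_nhds ht] with s hs using h.trace_comp_jacobi hG hE hs))
  rw [map_add, h.trace_deriv_comp ht] at h2
  simp only [ContinuousLinearMap.comp_sub, ContinuousLinearMap.comp_add, map_sub, map_add] at h2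
  linarith

/-- The algebraic relation between the curvature invariants of the velocity of a geodesic that
carries a constrained solution of the Riccati equation. -/
theorem curvature_relation (h : IsRiccatiAlong G S I c V U U') (hG : IsMetricOn G S)
    (hE : Module.finrank ℝ E = 3) (ht : t ∈ I) (hunit : G (c t) (V t) (V t) = 1)
    {J K : E →L[ℝ] E} (hJ : J = jacobi G (c t) (V t)) (hK : K = derivedJacobiL G (c t) (V t)) :
    ((traceL E (J ∘L J) - 1 / 2 * traceL E J ^ 2) *
        (2 * traceL E (J ∘L J) - ricci G (c t) (V t) (V t) ^ 2
          + covRicci2 G (c t) (V t) (V t) (V t) (V t)) -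
      (traceL E (J ∘L K) - 1 / 2 * traceL E J * traceL E K) *
        covRicciForm G (c t) (V t) (V t) (V t)) ^ 2 =
    -(1 / 2) * traceL E ((J ∘L K - K ∘L J) ∘L (J ∘L K - K ∘L J)) *
      (-covRicciForm G (c t) (V t) (V t) (V t) ^ 2 -
        4 * (traceL E (J ∘L J) - 1 / 2 * traceL E J ^ 2) * ricci G (c t) (V t) (V t)) := by
  have hy := h.mem t ht
  have hJx : J (V t) = 0 := by rw [hJ, jacobi_apply, riemann_self, zero_apply]
  have hKx : K (V t) = 0 := by rw [hK, derivedJacobiL_apply, derivedJacobi_self hG hy]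
  obtain ⟨h1, h2⟩ := trace_relation_of_symmetric hE
    ((ContinuousLinearMap.coeLM ℝ) ∘ₗ (G (c t)).toLinearMap) (hG.symm _ hy) (hG.pos _ hy) hunit
    (J := J) (K := K) (U := U t)
    (by rw [hJ]; exact h.jacobi_symmetric hG ht) (by rw [hK]; exact h.derivedJacobi_symmetric hG ht)
    (h.symmetric t ht) hJx hKx (h.velocity t ht) (h.traceFree t ht)
  change traceL E (U t ∘L U t ∘L J) = 1 / 2 * traceL E (U t ∘L U t) * traceL E J at h1
  change ((traceL E (J ∘L J) - 1 / 2 * traceL E J ^ 2) * (2 * traceL E (U t ∘L K)) -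
      (traceL E (J ∘L K) - 1 / 2 * traceL E J * traceL E K) * (2 * traceL E (U t ∘L J))) ^ 2 =
    -(1 / 2) * traceL E ((J ∘L K - K ∘L J) ∘L (J ∘L K - K ∘L J)) *
      (-(2 * traceL E (U t ∘L J)) ^ 2 +
        4 * (traceL E (J ∘L J) - 1 / 2 * traceL E J ^ 2) * traceL E (U t ∘L U t)) at h2
  have h3 := h.trace_comp_jacobi hG hE ht
  have h4 := h.trace_comp_derivedJacobi hG hE ht
  have h5 : ricci G (c t) (V t) (V t) = traceL E J := by rw [hJ, ricci_eq_trace_jacobi]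
  have h6 := h.trace_sq ht
  rw [← hJ] at h3 h4
  -- The term `2 tr(U²J)` equals `tr U² tr J = -ric²`, which produces the middle term of `D₂`.
  rw [← hK, h1, h6, h5] at h4
  rw [h3, h6, h5] at h2
  rw [h5]
  have h7 : 2 * traceL E (U t ∘L K) = 2 * traceL E (J ∘L J) - traceL E J ^ 2
      + covRicci2 G (c t) (V t) (V t) (V t) (V t) := by
    rw [h4]
    ring
  rw [← h7]
  linear_combination h2

end IsRiccatiAlong

end AlongGeodesic

/-! ### The coordinate expression of the metric -/

section ChartMetric

variable {M : Type*} [TopologicalSpace M] [ChartedSpace E3 M] [IsManifold (𝓡 3) ∞ M]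

theorem chartDiff_isInvertible {p x : M} (hx : x ∈ (chartAt E3 p).source) :
    (chartDiff p x).IsInvertible :=
  isInvertible_mfderiv_extChartAt (by simpa using hx)

theorem chartDiff_comp_chartDiffInv {p x : M} (hx : x ∈ (chartAt E3 p).source) :
    chartDiff p x ∘L chartDiffInv p x = ContinuousLinearMap.id ℝ E3 :=
  (chartDiff_isInvertible hx).self_comp_inverse

theorem chartDiffInv_comp_chartDiff {p x : M} (hx : x ∈ (chartAt E3 p).source) :
    chartDiffInv p x ∘L chartDiff p x = ContinuousLinearMap.id ℝ (TangentSpace (𝓡 3) x) :=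
  (chartDiff_isInvertible hx).inverse_comp_self

theorem chartDiff_chartDiffInv {p x : M} (hx : x ∈ (chartAt E3 p).source) (v : E3) :
    chartDiff p x (chartDiffInv p x v) = v :=
  DFunLike.congr_fun (chartDiff_comp_chartDiffInv hx) v

theorem chartDiffInv_chartDiff {p x : M} (hx : x ∈ (chartAt E3 p).source)
    (v : TangentSpace (𝓡 3) x) : chartDiffInv p x (chartDiff p x v) = v :=
  DFunLike.congr_fun (chartDiffInv_comp_chartDiff hx) v

/-- The differential of the preferred chart as a linear equivalence. -/
def chartDiffEquiv {p x : M} (hx : x ∈ (chartAt E3 p).source) :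
    TangentSpace (𝓡 3) x ≃ₗ[ℝ] E3 :=
  LinearEquiv.ofLinearMap (chartDiff p x).toLinearMap (chartDiffInv p x).toLinearMap
    (LinearMap.ext (chartDiff_chartDiffInv hx)) (LinearMap.ext (chartDiffInv_chartDiff hx))

omit [IsManifold (𝓡 3) ∞ M] in
theorem extChartAt_symm_mem_source {p : M} {y : E3} (hy : y ∈ (extChartAt (𝓡 3) p).target) :
    (extChartAt (𝓡 3) p).symm y ∈ (chartAt E3 p).source := by
  rw [← extChartAt_source (𝓡 3)]
  exact (extChartAt (𝓡 3) p).map_target hy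

/-- Smoothness of `g` is given in bundle trivializations; this identifies their fibre maps with the
chart differentials that define `chartMetric`. -/
theorem chartDiffInv_eq_symm {p x : M} (hx : x ∈ (chartAt E3 p).source) (v : E3) :
    chartDiffInv p x v = (trivializationAt E3 (TangentSpace (𝓡 3)) p).symm x v := by
  have hx' : x ∈ (trivializationAt E3 (TangentSpace (𝓡 3)) p).baseSet := by simpa using hx
  have h1 := TangentBundle.continuousLinearMapAt_trivializationAt (I := 𝓡 3) hx
  have h2 : chartDiff p x ((trivializationAt E3 (TangentSpace (𝓡 3)) p).symm x v) = v := by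
    have h3 := (trivializationAt E3 (TangentSpace (𝓡 3)) p).continuousLinearMapAt_symmL (R := ℝ)
      hx' v
    rw [h1, Bundle.Trivialization.symmL_apply _ hx'] at h3
    exact h3
  rw [← chartDiffInv_chartDiff hx ((trivializationAt E3 (TangentSpace (𝓡 3)) p).symm x v), h2]

theorem chartMetric_extChartAt (g : RiemannianMetric3 M) {p x : M}
    (hx : x ∈ (chartAt E3 p).source) (v w : E3) :
    chartMetric g p (extChartAt (𝓡 3) p x) v w =
      g.inner x (chartDiffInv p x v) (chartDiffInv p x w) := by
  -- The base points agree only propositionally and the tangent spaces depend on them, so the point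
  -- is generalized before substitution.
  have h : ∀ x', x' = x → g.inner x' (chartDiffInv p x' v) (chartDiffInv p x' w) =
      g.inner x (chartDiffInv p x v) (chartDiffInv p x w) := by
    rintro _ rfl
    rfl
  exact h _ ((extChartAt (𝓡 3) p).left_inv (by simpa using hx))

theorem chartMetric_smooth (g : RiemannianMetric3 M) {p : M} {y : E3}
    (hy : y ∈ (extChartAt (𝓡 3) p).target) : ContDiffAt ℝ ∞ (chartMetric g p) y := by
  let x := (extChartAt (𝓡 3) p).symm y
  have hx : x ∈ (chartAt E3 p).source := extChartAt_symm_mem_source hy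
  let e := trivializationAt (E3 →L[ℝ] E3 →L[ℝ] ℝ)
    (fun b : M => TangentSpace (𝓡 3) b →L[ℝ] TangentSpace (𝓡 3) b →L[ℝ] ℝ) p
  have h1 := ((e.contMDiffAt_iff (f := fun b => ⟨b, g.inner b⟩) (x₀ := x) (IB := 𝓡 3)
    (by simpa [e] using hx)).1 (g.contMDiff x)).2
  have h2 : ContMDiffAt 𝓘(ℝ, E3) (𝓡 3) ∞ (extChartAt (𝓡 3) p).symm y :=
    (contMDiffOn_extChartAt_symm p).contMDiffAt
      ((isOpen_extChartAt_target p).mem_nhds hy)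
  have h3 := (ContMDiffAt.comp y h1 h2).contDiffAt
  refine h3.congr_of_eventuallyEq ?_
  filter_upwards [(isOpen_extChartAt_target (I := 𝓡 3) p).mem_nhds hy] with z hz
  have hzs : (extChartAt (𝓡 3) p).symm z ∈ (chartAt E3 p).source :=
    extChartAt_symm_mem_source hz
  ext v w
  rw [chartMetric_apply, chartDiffInv_eq_symm hzs, chartDiffInv_eq_symm hzs]
  have hzb : (extChartAt (𝓡 3) p).symm z ∈
      (trivializationAt E3 (TangentSpace (𝓡 3)) p).baseSet := by
    rw [TangentBundle.trivializationAt_baseSet]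
    exact hzs
  have h4 := inCoordinates_apply_eq₂ (𝕜 := ℝ) (F₁ := E3) (E₁ := TangentSpace (𝓡 3)) (F₂ := E3)
    (E₂ := TangentSpace (𝓡 3)) (F₃ := ℝ) (E₃ := Bundle.Trivial M ℝ)
    (ϕ := g.inner ((extChartAt (𝓡 3) p).symm z)) (v := v) (w := w) hzb hzb (Set.mem_univ _)
  exact (h4.trans (LinearMap.congr_fun
    (Bundle.Trivial.linearMapAt_trivialization ℝ M ℝ ((extChartAt (𝓡 3) p).symm z)) _)).symm

theorem chartMetric_isMetricOn (g : RiemannianMetric3 M) (p : M) :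
    IsMetricOn (chartMetric g p) (extChartAt (𝓡 3) p).target where
  isOpen := isOpen_extChartAt_target p
  smooth _ hy := chartMetric_smooth g hy
  symm _ _ _ _ := g.symm _ _ _
  pos y hy v hv := by
    have hx : (extChartAt (𝓡 3) p).symm y ∈ (chartAt E3 p).source :=
      extChartAt_symm_mem_source hy
    refine g.pos _ _ fun h0 => hv ?_
    exact (chartDiff_chartDiffInv hx v).symm.trans
      ((congrArg (chartDiff p _) h0).trans (map_zero _))

end ChartMetric

/-! ### The invariants as homogeneous polynomials in the chart -/

section Invariants

variable {M : Type*} [TopologicalSpace M] [ChartedSpace E3 M] [IsManifold (𝓡 3) ∞ M]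
  (g : RiemannianMetric3 M) (p : M)

/-- The endomorphism of `T_pM` with a given expression in the preferred chart around `p`. -/
def chartConj (A : E3 →L[ℝ] E3) : TangentSpace (𝓡 3) p →ₗ[ℝ] TangentSpace (𝓡 3) p :=
  (chartDiffEquiv (mem_chart_source E3 p)).symm.conj A.toLinearMap

theorem chartConj_comp (A B : E3 →L[ℝ] E3) :
    chartConj p A ∘ₗ chartConj p B = chartConj p (A ∘L B) :=
  (LinearEquiv.conj_comp _ _ _).symm

theorem chartConj_sub (A B : E3 →L[ℝ] E3) :
    chartConj p A - chartConj p B = chartConj p (A - B) :=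
  (map_sub _ _ _).symm

theorem trace_chartConj (A : E3 →L[ℝ] E3) :
    LinearMap.trace ℝ _ (chartConj p A) = traceL E3 A :=
  LinearMap.trace_conj' _ _

/-- The coordinates of `p` in its preferred chart. -/
abbrev basePoint (p : M) : E3 := extChartAt (𝓡 3) p p

omit [IsManifold (𝓡 3) ∞ M] in
theorem basePoint_mem_target : basePoint p ∈ (extChartAt (𝓡 3) p).target :=
  mem_extChartAt_target p

theorem jacobiAt_self (X : TangentSpace (𝓡 3) p) : jacobiAt g p X X = 0 := by
  have h : jacobi (chartMetric g p) (basePoint p) (chartDiff p p X) (chartDiff p p X) = 0 := by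
    rw [jacobi_apply, riemann_self, zero_apply]
  exact (congrArg (chartDiffInv p p) h).trans (map_zero _)

theorem derivedJacobiAt_self (X : TangentSpace (𝓡 3) p) : derivedJacobiAt g p X X = 0 := by
  have h := derivedJacobi_self (chartMetric_isMetricOn g p) (basePoint_mem_target p)
    (chartDiff p p X)
  exact (congrArg (chartDiffInv p p) h).trans (map_zero _)

/-- The Jacobi operator at `p`, in the preferred chart around `p`. -/
abbrev chartJ (x : E3) : E3 →L[ℝ] E3 := jacobi (chartMetric g p) (basePoint p) x

/-- The derived Jacobi operator at `p`, in the preferred chart around `p`. -/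
abbrev chartJ' (x : E3) : E3 →L[ℝ] E3 := derivedJacobiL (chartMetric g p) (basePoint p) x

theorem jacobiAt_eq (X : TangentSpace (𝓡 3) p) :
    jacobiAt g p X = chartConj p (chartJ g p (chartDiff p p X)) := rfl

theorem derivedJacobiAt_eq (X : TangentSpace (𝓡 3) p) :
    derivedJacobiAt g p X = chartConj p (chartJ' g p (chartDiff p p X)) := rfl

theorem chartJ_zero : chartJ g p 0 = 0 := by
  ext z
  simp [chartJ, jacobi_apply]

theorem ringJ_zero : ringJ g p 0 = 0 := by
  have h : jacobiAt g p 0 = 0 := by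
    rw [jacobiAt_eq, map_zero, chartJ_zero, ← sub_zero (0 : E3 →L[ℝ] E3), ← chartConj_sub, sub_self]
  have h2 : onPerp g p 0 (0 : TangentSpace (𝓡 3) p →ₗ[ℝ] TangentSpace (𝓡 3) p) = 0 := by
    ext Y
    simp [coe_onPerp]
  rw [ringJ, h, ringPart, h2, map_zero, mul_zero, zero_smul, sub_zero]

/-- `trRingJJ` in the chart. -/
def chartTrJJ (x : E3) : ℝ :=
  traceL E3 (chartJ g p x ∘L chartJ g p x) - 1 / 2 * traceL E3 (chartJ g p x) ^ 2

/-- `trRingJJ'` in the chart. -/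
def chartTrJJ' (x : E3) : ℝ :=
  traceL E3 (chartJ g p x ∘L chartJ' g p x)
    - 1 / 2 * traceL E3 (chartJ g p x) * traceL E3 (chartJ' g p x)

/-- `invD` in the chart. -/
def chartD (x : E3) : ℝ :=
  -(1 / 2) * traceL E3 ((chartJ g p x ∘L chartJ' g p x - chartJ' g p x ∘L chartJ g p x) ∘L
    (chartJ g p x ∘L chartJ' g p x - chartJ' g p x ∘L chartJ g p x))

/-- `invD1` in the chart. -/
def chartD1 (x : E3) : ℝ := covRicciForm (chartMetric g p) (basePoint p) x x x

/-- `invD2` in the chart. -/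
def chartD2 (x : E3) : ℝ :=
  2 * traceL E3 (chartJ g p x ∘L chartJ g p x) - ricci (chartMetric g p) (basePoint p) x x ^ 2
    + covRicci2 (chartMetric g p) (basePoint p) x x x x

/-- `invP` in the chart. -/
def chartP (x : E3) : ℝ := chartTrJJ g p x * chartD2 g p x - chartTrJJ' g p x * chartD1 g p x

variable (X : TangentSpace (𝓡 3) p)

theorem trRingJJ_eq : trRingJJ g p X = chartTrJJ g p (chartDiff p p X) := by
  -- For `X = 0` the complement is 3-dimensional and the plane formula does not apply; both sides
  -- vanish.
  rcases eq_or_ne X 0 with rfl | hX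
  · rw [trRingJJ, ringJ_zero, chartTrJJ, map_zero, chartJ_zero]
    simp
  · rw [trRingJJ, ringJ, trace_ringPart_comp g p hX (jacobiAt_self g p X) (jacobiAt_self g p X),
      jacobiAt_eq, chartConj_comp, trace_chartConj, trace_chartConj, chartTrJJ]
    ring

theorem trRingJJ'_eq : trRingJJ' g p X = chartTrJJ' g p (chartDiff p p X) := by
  rcases eq_or_ne X 0 with rfl | hX
  · rw [trRingJJ', ringJ_zero, chartTrJJ', map_zero, chartJ_zero]
    simp
  · rw [trRingJJ', ringJ, ringJ', trace_ringPart_comp g p hX (jacobiAt_self g p X)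
      (derivedJacobiAt_self g p X), jacobiAt_eq, derivedJacobiAt_eq, chartConj_comp,
      trace_chartConj, trace_chartConj, trace_chartConj, chartTrJJ']

theorem invD_eq : invD g p X = chartD g p (chartDiff p p X) := by
  rcases eq_or_ne X 0 with rfl | hX
  -- The determinant of the zero map on `X^⊥` is `0` only because that space has positive dimension;
  -- here it is the whole tangent space.
  · have hp : perp g p (0 : TangentSpace (𝓡 3) p) = ⊤ := by
      ext Y
      simp [perp]
    have hd : Module.finrank ℝ (perp g p (0 : TangentSpace (𝓡 3) p)) = 3 := by
      rw [hp, finrank_top, finrank_tangentSpace]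
    rw [invD, ringJ_zero, chartD, map_zero, chartJ_zero, LinearMap.zero_comp, LinearMap.comp_zero,
      sub_zero, LinearMap.det_zero, hd]
    simp only [ContinuousLinearMap.zero_comp, ContinuousLinearMap.comp_zero, sub_zero, map_zero,
      mul_zero]
    norm_num
  · rw [invD, ringJ, ringJ', det_ringPart_commutator g p hX (jacobiAt_self g p X)
      (derivedJacobiAt_self g p X), jacobiAt_eq, derivedJacobiAt_eq, chartConj_comp,
      chartConj_comp, chartConj_sub, chartConj_comp, trace_chartConj, chartD]

theorem invD1_eq : invD1 g p X = chartD1 g p (chartDiff p p X) :=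
  (chartMetric_isMetricOn g p).covRicci_eq (basePoint_mem_target p) _ _ _

theorem invD2_eq : invD2 g p X = chartD2 g p (chartDiff p p X) := by
  rw [invD2, chartD2, jacobiAt_eq, chartConj_comp, trace_chartConj]
  rfl

theorem invP_eq : invP g p X = chartP g p (chartDiff p p X) := by
  rw [invP, chartP, trRingJJ_eq, trRingJJ'_eq, invD1_eq, invD2_eq]

theorem ricAt_eq : ricAt g p X = traceL E3 (chartJ g p (chartDiff p p X)) := rfl

theorem isHomPoly_chartTrJJ : IsHomPoly 4 (chartTrJJ g p) := by
  have hJ := isHomPoly_jacobi (G := chartMetric g p) (basePoint p)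
  have h := (hJ.clm_comp hJ).trace.sub ((hJ.trace.mul hJ.trace).const_mul (1 / 2))
  simp only [← pow_two] at h
  exact h

theorem isHomPoly_chartTrJJ' : IsHomPoly 5 (chartTrJJ' g p) := by
  have hJ := isHomPoly_jacobi (G := chartMetric g p) (basePoint p)
  have hK := isHomPoly_derivedJacobiL (G := chartMetric g p) (basePoint p)
  exact (hJ.clm_comp hK).trace.sub ((hJ.trace.const_mul (1 / 2)).mul hK.trace)

theorem isHomPoly_chartD : IsHomPoly 10 (chartD g p) := by
  have hJ := isHomPoly_jacobi (G := chartMetric g p) (basePoint p)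
  have hK := isHomPoly_derivedJacobiL (G := chartMetric g p) (basePoint p)
  have hC := (hJ.clm_comp hK).sub (hK.clm_comp hJ)
  exact (hC.clm_comp hC).trace.const_mul (-(1 / 2))

theorem isHomPoly_chartD1 : IsHomPoly 3 (chartD1 g p) := isHomPoly_covRicciForm _

theorem isHomPoly_chartD2 : IsHomPoly 4 (chartD2 g p) := by
  have hJ := isHomPoly_jacobi (G := chartMetric g p) (basePoint p)
  have h := (((hJ.clm_comp hJ).trace.const_mul 2).sub (hJ.trace.mul hJ.trace)).add
    ((chartMetric_isMetricOn g p).isHomPoly_covRicci2 (basePoint_mem_target p))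
  simp only [← pow_two] at h
  exact h

theorem isHomPoly_chartP : IsHomPoly 8 (chartP g p) :=
  ((isHomPoly_chartTrJJ g p).mul (isHomPoly_chartD2 g p)).sub
    ((isHomPoly_chartTrJJ' g p).mul (isHomPoly_chartD1 g p))

/-- The defect of the algebraic relation, in the chart. -/
def chartDefect (x : E3) : ℝ :=
  chartP g p x ^ 2 - chartD g p x *
    (-(chartD1 g p x) ^ 2 - 4 * chartTrJJ g p x * traceL E3 (chartJ g p x))

theorem isHomPoly_chartDefect : IsHomPoly 16 (chartDefect g p) := by
  have hJ := isHomPoly_jacobi (G := chartMetric g p) (basePoint p)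
  have hP := isHomPoly_chartP g p
  have hD1 := isHomPoly_chartD1 g p
  have h := (hP.mul hP).sub ((isHomPoly_chartD g p).mul
    ((hD1.mul hD1).neg.sub (((isHomPoly_chartTrJJ g p).const_mul 4).mul hJ.trace)))
  simp only [← pow_two] at h
  exact h

theorem defect_eq : invP g p X ^ 2
      - invD g p X * (-(invD1 g p X) ^ 2 - 4 * trRingJJ g p X * ricAt g p X) =
    chartDefect g p (chartDiff p p X) := by
  rw [invP_eq, invD_eq, invD1_eq, trRingJJ_eq, ricAt_eq, chartDefect]

end Invariants

/-! ### The relation for unit vectors and its extension by homogeneity -/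

section Main

variable {M : Type*} [TopologicalSpace M] [ChartedSpace E3 M] [IsManifold (𝓡 3) ∞ M]
  {g : RiemannianMetric3 M} {p : M}

/-- A constrained solution of the Riccati equation along a geodesic, read in the preferred chart
on a short time interval. -/
theorem exists_isRiccatiAlong {v : TangentSpace (𝓡 3) p} (hv : v ≠ 0) {ε : ℝ} (hε : 0 < ε)
    {γ : ℝ → M} (hγ : IsGeodesicFrom g p v ε γ)
    {u : ∀ t, TangentSpace (𝓡 3) (γ t) →L[ℝ] TangentSpace (𝓡 3) (γ t)}
    (hu : IsConstrainedRiccatiSolution g p ε γ u) :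
    ∃ I : Set ℝ, 0 ∈ I ∧ IsRiccatiAlong (chartMetric g p) (extChartAt (𝓡 3) p).target I
      (chartCurve p γ) (deriv (chartCurve p γ)) (chartEndo p γ u) (deriv (chartEndo p γ u)) := by
  have h0 : (0 : ℝ) ∈ Set.Ioo (-ε) ε := ⟨by linarith, hε⟩
  have hd1 : ContDiffOn ℝ 1 (deriv (chartCurve p γ)) (Set.Ioo (-ε) ε) :=
    hγ.contDiffOn.deriv_of_isOpen isOpen_Ioo (by norm_num)
  have hV0 : deriv (chartCurve p γ) 0 ≠ 0 := by
    rw [hγ.velocity]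
    intro h
    apply hv
    rw [← chartDiffInv_chartDiff (mem_chart_source E3 p) v]
    exact (congrArg (chartDiffInv p p) h).trans (map_zero _)
  -- Restricting to times of nonzero velocity keeps an open neighbourhood of `0` and avoids proving
  -- that geodesics have constant speed; unit speed is used only at `0`.
  refine ⟨Set.Ioo (-ε) ε ∩ deriv (chartCurve p γ) ⁻¹' {0}ᶜ, ⟨h0, hV0⟩, ?_⟩
  exact
    { isOpen := hd1.continuousOn.isOpen_inter_preimage isOpen_Ioo isOpen_compl_singleton
      mem := fun t ht => (extChartAt (𝓡 3) p).map_source (by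
        rw [extChartAt_source]; exact hγ.mem_source t ht.1)
      hasDerivAt := fun t ht => ((hγ.contDiffOn.contDiffAt
        (isOpen_Ioo.mem_nhds ht.1)).differentiableAt (by norm_num)).hasDerivAt
      geodesic := fun t ht => by
        rw [← eq_neg_of_add_eq_zero_left (hγ.geodesic t ht.1)]
        exact ((hd1.contDiffAt (isOpen_Ioo.mem_nhds ht.1)).differentiableAt
          (by norm_num)).hasDerivAt
      ne_zero := fun t ht => ht.2
      hasDerivAt_endo := fun t ht =>
        (hu.differentiableOn.differentiableAt (isOpen_Ioo.mem_nhds ht.1)).hasDerivAt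
      riccati := fun t ht => hu.riccati t ht.1
      symmetric := fun t ht x y => by
        have hs := hγ.mem_source t ht.1
        have hdu : ∀ z, chartDiffInv p (γ t) (chartEndo p γ u t z) =
            u t (chartDiffInv p (γ t) z) := fun z => chartDiffInv_chartDiff hs _
        rw [chartCurve, chartMetric_extChartAt g hs, chartMetric_extChartAt g hs, hdu, hdu]
        exact hu.symmetric t ht.1 _ _
      traceFree := fun t ht => by
        have hs := hγ.mem_source t ht.1
        have h : (chartEndo p γ u t).toLinearMap =
          (chartDiffEquiv hs).conj (u t).toLinearMap := rfl
        rw [traceL_apply, h, LinearMap.trace_conj']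
        exact hu.traceFree t ht.1
      velocity := fun t ht => hu.velocity t ht.1 }

theorem chartDefect_eq_zero_of_unit (hg : HasConstrainedRiccatiSolutions g)
    {v : TangentSpace (𝓡 3) p} (hv : g.inner p v v = 1) :
    chartDefect g p (chartDiff p p v) = 0 := by
  have hv0 : v ≠ 0 := by
    rintro rfl
    simp at hv
  obtain ⟨ε, hε, γ, hγ, u, hu⟩ := hg p v hv
  obtain ⟨I, h0, hI⟩ := exists_isRiccatiAlong hv0 hε hγ hu
  have hc : chartCurve p γ 0 = basePoint p := by rw [chartCurve, hγ.start]
  have hs := mem_chart_source E3 p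
  have hunit : chartMetric g p (chartCurve p γ 0) (deriv (chartCurve p γ) 0)
      (deriv (chartCurve p γ) 0) = 1 := by
    rw [hc, hγ.velocity, chartMetric_extChartAt g hs]
    have h := chartDiffInv_chartDiff hs v
    exact (congrArg₂ (fun a b => g.inner p a b) h h).trans hv
  have key := hI.curvature_relation (chartMetric_isMetricOn g p)
    (finrank_euclideanSpace_fin (𝕜 := ℝ) (n := 3)) h0 hunit rfl rfl
  rw [hc, hγ.velocity] at key
  rw [chartDefect, sub_eq_zero]
  exact key

theorem chartDefect_eq_zero (hg : HasConstrainedRiccatiSolutions g)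
    (X : TangentSpace (𝓡 3) p) : chartDefect g p (chartDiff p p X) = 0 := by
  have hhom := isHomPoly_chartDefect g p
  rcases eq_or_ne X 0 with rfl | hX
  · have h := hhom.map_smul 0 0
    rw [map_zero]
    simpa using h
  · have hpos := g.pos p X hX
    have hne : Real.sqrt (g.inner p X X) ≠ 0 := (Real.sqrt_pos.mpr hpos).ne'
    have hunit : g.inner p ((Real.sqrt (g.inner p X X))⁻¹ • X)
        ((Real.sqrt (g.inner p X X))⁻¹ • X) = 1 := by
      have hsq : ∀ c : ℝ, g.inner p (c • X) (c • X) = c * (c * g.inner p X X) := fun c => by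
        rw [map_smul, g.symm, map_smul]
        rfl
      rw [hsq, ← mul_assoc, ← mul_inv, Real.mul_self_sqrt hpos.le, inv_mul_cancel₀ hpos.ne']
    have h := chartDefect_eq_zero_of_unit hg hunit
    rw [map_smul, hhom.map_smul] at h
    exact (mul_eq_zero.mp h).resolve_left (pow_ne_zero _ (inv_ne_zero hne))

end Main

end

theorem theorem3p1 {M : Type*} [TopologicalSpace M] [ChartedSpace E3 M] [IsManifold (𝓡 3) ∞ M]
    (g : RiemannianMetric3 M) :
    (∀ p : M,
      IsHomogeneousPolynomial 3 (invD1 g p) ∧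
      IsHomogeneousPolynomial 4 (invD2 g p) ∧
      IsHomogeneousPolynomial 10 (invD g p) ∧
      IsHomogeneousPolynomial 8 (invP g p) ∧
      IsHomogeneousPolynomial 16 (fun X : TangentSpace (𝓡 3) p =>
        invP g p X ^ 2
          - invD g p X * (-(invD1 g p X) ^ 2 - 4 * trRingJJ g p X * ricAt g p X))) ∧
    (HasConstrainedRiccatiSolutions g →
      ∀ (p : M) (X : TangentSpace (𝓡 3) p),
        invP g p X ^ 2
          = invD g p X * (-(invD1 g p X) ^ 2 - 4 * trRingJJ g p X * ricAt g p X)) := by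
  refine ⟨fun p => ?_, fun hg p X => ?_⟩
  · refine ⟨?_, ?_, ?_, ?_, ?_⟩
    · rw [funext (invD1_eq g p)]
      exact (isHomPoly_chartD1 g p).isHomogeneousPolynomial (chartDiffEquiv (mem_chart_source E3 p))
    · rw [funext (invD2_eq g p)]
      exact (isHomPoly_chartD2 g p).isHomogeneousPolynomial (chartDiffEquiv (mem_chart_source E3 p))
    · rw [funext (invD_eq g p)]
      exact (isHomPoly_chartD g p).isHomogeneousPolynomial (chartDiffEquiv (mem_chart_source E3 p))
    · rw [funext (invP_eq g p)]
      exact (isHomPoly_chartP g p).isHomogeneousPolynomial (chartDiffEquiv (mem_chart_source E3 p))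
    · rw [funext (defect_eq g p)]
      exact (isHomPoly_chartDefect g p).isHomogeneousPolynomial
        (chartDiffEquiv (mem_chart_source E3 p))
  · rw [← sub_eq_zero, defect_eq]
    exact chartDefect_eq_zero hg X
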